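/- Let $\alpha\in\mathbb R$ and $\beta>-1$. Let $\mathcal Y_{\alpha,\beta}$ be the class of all transcendental meromorphic functions $f$ in $\mathbb C$ such that the family $(f_h)_{|h|\ge 1}$, $f_h(z)=h^{-\alpha}f(h+h^{-\beta}z)$ (for some fixed determination of the powers, say the principal one), is normal in $\mathbb C$ with respect to the spherical metric, and no limit function $\lim f_{h_n}$ with $h_n\to\infty$ (locally uniform limit in the spherical metric) is constant, finite or $\infty$. For an integer $g\ge 0$ let $E(u,g)=(1-u)\exp\big(u+\tfrac{u^2}{2}+\cdots+\tfrac{u^g}{g}\big)$. For $f\in\mathcal Y_{\alpha,\beta}$ let $q$ and $p$ run through the non-zero zeros and the non-zero poles of $f$, respectively, each repeated according to its multiplicity. (i) For every $f\in\mathcal Y_{\alpha,\beta}$ and every integer $m>\beta$ there are $s\in\mathbb Z$ and a polynomial $S$ with $\deg S\le m$ such that $$f(z)=z^se^{S(z)}\lim_{r\to\infty}\frac{\prod_{|q|<r}E\big(\frac zq,m\big)}{\prod_{|p|<r}E\big(\frac zp,m\big)}.$$ (ii) If $\beta$ is an integer, then for every $f\in\mathcal Y_{\alpha,\beta}$ there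 are a sequence $r_k\to\infty$, $s\in\mathbb Z$ and a polynomial $S$ with $\deg S\le\beta+1$ such that $$f(z)=z^se^{S(z)}\lim_{k\to\infty}\frac{\prod_{|q|<r_k}E\big(\frac zq,\beta\big)}{\prod_{|p|<r_k}E\big(\frac zp,\beta\big)}.$$ (iii) In particular, if $\beta=0$, then for every $f\in\mathcal Y_{\alpha,0}$ there are a sequence $r_k\to\infty$, $s\in\mathbb Z$ and $a,c\in\mathbb C$ such that $$f(z)=z^se^{az+c}\lim_{k\to\infty}\frac{\prod_{|q|<r_k}\big(1-\frac zq\big)}{\prod_{|p|<r_k}\big(1-\frac zp\big)}\quad\text{and}\quad \frac{f'(z)}{f(z)}=a+\frac sz+\lim_{k\to\infty}\Big[\sum_{|q|<r_k}\frac1{z-q}-\sum_{|p|<r_k}\frac1{z-p}\Big].$$ The products, including the prefactor $z^se^{S(z)}$ (resp. $z^se^{az+c}$), converge to $f$ locally uniformly in $\mathbb C$ minus the poles of $f$. The last limit, including the terms $a+\frac sz$, is locally uniform in $\mathbb C$ minus the zeros and poles of $f$. -/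

import Mathlib

open Filter Topology

noncomputable section

namespace Yosida

/-- The chordal (spherical) distance on the Riemann sphere `ℂ ∪ {∞}`. -/
def chordal : OnePoint ℂ → OnePoint ℂ → ℝ
  | OnePoint.some a, OnePoint.some b =>
      ‖a - b‖ / (Real.sqrt (1 + ‖a‖ ^ 2) * Real.sqrt (1 + ‖b‖ ^ 2))
  | OnePoint.some a, OnePoint.infty => 1 / Real.sqrt (1 + ‖a‖ ^ 2)
  | OnePoint.infty, OnePoint.some b => 1 / Real.sqrt (1 + ‖b‖ ^ 2)
  | OnePoint.infty, OnePoint.infty => 0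

open Classical in
/-- A meromorphic function (in normal form), regarded as a map into the Riemann sphere:
the value at a pole is `∞`. -/
def toSphere (f : ℂ → ℂ) (z : ℂ) : OnePoint ℂ :=
  if meromorphicOrderAt f z < 0 then OnePoint.infty else (f z : OnePoint ℂ)

/-- Locally uniform convergence in `ℂ` with respect to the spherical metric. -/
def SphericalTendsto (F : ℕ → ℂ → OnePoint ℂ) (φ : ℂ → OnePoint ℂ) : Prop :=
  ∀ K : Set ℂ, IsCompact K → ∀ ε : ℝ, 0 < ε →
    ∀ᶠ n in atTop, ∀ z ∈ K, chordal (F n z) (φ z) < ε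

/-- The re-scaled function `f_h(z) = h^{-α} f(h + h^{-β} z)` (principal determination of the
powers). -/
def rescale (α β : ℝ) (f : ℂ → ℂ) (h z : ℂ) : ℂ :=
  h ^ (-(α : ℂ)) * f (h + h ^ (-(β : ℂ)) * z)

/-- The function agrees with a quotient of two polynomials wherever the denominator does not
vanish. -/
def IsRational (f : ℂ → ℂ) : Prop :=
  ∃ P Q : Polynomial ℂ, Q ≠ 0 ∧ ∀ z, Q.eval z ≠ 0 → f z = P.eval z / Q.eval z

/-- The class `Y_{α,β}` of generalised Yosida functions (for `β > -1`). A meromorphic function in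
`ℂ` is represented by a function `ℂ → ℂ` in normal form, i.e. it has its correct values off the
poles and the value `0` at the poles. -/
structure IsYosida (α β : ℝ) (f : ℂ → ℂ) : Prop where
  meromorphic : MeromorphicNFOn f Set.univ
  transcendental : ¬ IsRational f
  /-- The family `(f_h)`, `|h| ≥ 1`, is normal in `ℂ`. -/
  normal : ∀ h : ℕ → ℂ, (∀ n, 1 ≤ ‖h n‖) → ∃ k : ℕ → ℕ, StrictMono k ∧
    ∃ φ : ℂ → OnePoint ℂ, SphericalTendsto (fun n => toSphere (rescale α β f (h (k n)))) φ
  /-- No limit function `lim f_{h_n}` with `h_n → ∞` is constant (finite or `∞`). -/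
  limit_nonconstant : ∀ (h : ℕ → ℂ) (φ : ℂ → OnePoint ℂ),
    Tendsto (fun n => ‖h n‖) atTop atTop →
    SphericalTendsto (fun n => toSphere (rescale α β f (h n))) φ →
    ¬ ∃ c : OnePoint ℂ, ∀ z, φ z = c

/-- The multiplicity of `q` as a zero of `f` (`0` if `q` is not a zero). -/
def zeroMult (f : ℂ → ℂ) (q : ℂ) : ℕ := (meromorphicOrderAt f q).untop₀.toNat

/-- The multiplicity of `p` as a pole of `f` (`0` if `p` is not a pole). -/
def poleMult (f : ℂ → ℂ) (p : ℂ) : ℕ := (-(meromorphicOrderAt f p).untop₀).toNat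

/-- The Weierstrass prime factor `E(u, g) = (1 - u) exp(u + u²/2 + ⋯ + u^g/g)` of genus `g`. -/
def primeFactor (g : ℕ) (u : ℂ) : ℂ :=
  (1 - u) * Complex.exp (∑ j ∈ Finset.Icc 1 g, u ^ j / (j : ℂ))

/-- The finite product of `E(z/q)` over the non-zero zeros `|q| < r` of `f`, each zero counted
with its multiplicity. -/
def zeroProd (E : ℂ → ℂ) (f : ℂ → ℂ) (r : ℝ) (z : ℂ) : ℂ :=
  ∏ᶠ (q : ℂ) (_ : q ≠ 0 ∧ ‖q‖ < r), E (z / q) ^ zeroMult f q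

/-- The finite product of `E(z/p)` over the non-zero poles `|p| < r` of `f`, each pole counted
with its multiplicity. -/
def poleProd (E : ℂ → ℂ) (f : ℂ → ℂ) (r : ℝ) (z : ℂ) : ℂ :=
  ∏ᶠ (p : ℂ) (_ : p ≠ 0 ∧ ‖p‖ < r), E (z / p) ^ poleMult f p

/-- The finite sum of `1/(z-q)` over the non-zero zeros `|q| < r` of `f`, with multiplicity. -/
def zeroSum (f : ℂ → ℂ) (r : ℝ) (z : ℂ) : ℂ :=
  ∑ᶠ (q : ℂ) (_ : q ≠ 0 ∧ ‖q‖ < r), (zeroMult f q : ℂ) * (1 / (z - q))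

/-- The finite sum of `1/(z-p)` over the non-zero poles `|p| < r` of `f`, with multiplicity. -/
def poleSum (f : ℂ → ℂ) (r : ℝ) (z : ℂ) : ℂ :=
  ∑ᶠ (p : ℂ) (_ : p ≠ 0 ∧ ‖p‖ < r), (poleMult f p : ℂ) * (1 / (z - p))

end Yosida

end

/-! The proof is a residue argument on well-chosen circles. Suppose `∮ |f'/f| |dw| = O(r^(1+β))` on
`|w| = r`. Integrating `f'/f` against `w^(-m-1)` and `w^(-m-1)(w-z)^(-1)` expresses `f'/f` in the
disc as `s/z`, plus the sum of `n_a z^m / (a^m (z-a))` over the non-zero zeros and poles `a` in the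
disc (`n_a` the signed multiplicity), plus a polynomial of degree less than `m` that does not depend
on `r`, plus `γ_r z^m`, plus `z^(m+1) I_r(z)`. Here `γ_r = O(r^(β-m))` and `I_r = O(r^(β-m-1))` on
compact sets. The terms of the sum are the logarithmic derivatives of the factors `E(z/a, m)^(n_a)`,
so integration and exponentiation give the product formula up to a factor `exp(γ_r z^(m+1)/(m+1) +
ε_r(z))` with `ε_r → 0` for `m ≥ β`.

If `m > β`, then `γ_r → 0`. Arbitrary radii are allowed as well, because a thin annulus at radius
`R` contains `O(R^(1+β))` zeros and poles, and each of them changes the logarithm of the product by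
`O(R^(-m-1))`. If `m = β`, then `γ_r` is only bounded. A convergent subsequence of the `γ_r`
supplies the coefficient of `z^(β+1)` and forces the restriction to a sequence of radii. For `β = 0`
the locally uniform limit is differentiated logarithmically.

Good circles come from normality. Non-constant limits and a compactness argument show that in a disc
of radius comparable to `|h|^(-β)` about `h` either `f` or `1/f` is holomorphic and, on a concentric
annulus, comparable to its maximum. Hence such a disc contains boundedly many zeros and poles, and
`f'/f` has area integral `O(|h|^(-β))` over it (`disc_bounds`, `IsYosida.exists_local_bounds`). An
annulus of width comparable to `R^(-β)` is covered by `O(R^(1+β))` such discs, and averaging over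
the radius yields the circle (`IsYosida.exists_annulus_bounds`). The residue argument is
`exists_exp_representation`. -/

namespace Yosida

/-! ### Multiplicities and the removal of finitely many zeros and poles -/

/-- The multiplicity of `a` as a zero (positive) or pole (negative) of `f`. -/
noncomputable def mult (f : ℂ → ℂ) (a : ℂ) : ℤ := (meromorphicOrderAt f a).untop₀

/-- Finiteness matters: `untop₀` sends `⊤` to `0`, which would confuse a locally vanishing function
with a non-vanishing one. -/
lemma coe_mult {f : ℂ → ℂ} {a : ℂ} (h : meromorphicOrderAt f a ≠ ⊤) :
    meromorphicOrderAt f a = (mult f a : WithTop ℤ) := by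
  rw [mult, WithTop.coe_untop₀_of_ne_top h]

lemma mult_inv (f : ℂ → ℂ) (a : ℂ) : mult f⁻¹ a = -mult f a := by
  simp [mult, meromorphicOrderAt_inv]

lemma finite_mult_ne_zero {f : ℂ → ℂ} (hf : MeromorphicNFOn f Set.univ) (c : ℂ) (r : ℝ) :
    {a | a ∈ Metric.closedBall c r ∧ mult f a ≠ 0}.Finite := by
  have hm : MeromorphicOn f (Metric.closedBall c r) := fun z _ => (hf (Set.mem_univ z)).meromorphicAt
  refine ((MeromorphicOn.divisor f (Metric.closedBall c r)).finiteSupport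
    (isCompact_closedBall c r)).subset ?_
  rintro a ⟨ha, h⟩
  rw [Function.mem_support, MeromorphicOn.divisor_apply hm ha]
  exact h

section Factor

variable {f : ℂ → ℂ} {Z : Finset ℂ} {e : ℂ → ℂ → ℂ}

lemma order_prod_zpow (he : ∀ a ∈ Z, ∀ z, AnalyticAt ℂ (e a) z)
    (ho : ∀ a ∈ Z, ∀ z, meromorphicOrderAt (e a) z = if z = a then 1 else 0) (n : ℂ → ℤ) (z : ℂ) :
    meromorphicOrderAt (fun w => ∏ a ∈ Z, e a w ^ n a) z
      = if z ∈ Z then (n z : WithTop ℤ) else 0 := by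
  classical
  have hme : ∀ a ∈ Z, MeromorphicAt (fun w => e a w ^ n a) z :=
    fun a ha => ((he a ha z).meromorphicAt).fun_zpow (n a)
  rw [meromorphicOrderAt_fun_prod hme]
  have : ∀ a ∈ Z, meromorphicOrderAt (fun w => e a w ^ n a) z
      = if z = a then (n z : WithTop ℤ) else 0 := by
    intro a ha
    have := meromorphicOrderAt_zpow (n := n a) ((he a ha z).meromorphicAt)
    rw [ho a ha z] at this
    refine this.trans ?_
    split_ifs with h
    · subst h; simp
    · simp
  rw [Finset.sum_congr rfl this, Finset.sum_ite_eq]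

/-- Splitting off finitely many zeros and poles from a meromorphic function. -/
theorem exists_factor (hf : MeromorphicNFOn f Set.univ) (hfin : ∀ z, meromorphicOrderAt f z ≠ ⊤)
    (he : ∀ a ∈ Z, ∀ z, AnalyticAt ℂ (e a) z)
    (ho : ∀ a ∈ Z, ∀ z, meromorphicOrderAt (e a) z = if z = a then 1 else 0) :
    ∃ v : ℂ → ℂ, MeromorphicNFOn v Set.univ ∧
      (∀ z, meromorphicOrderAt v z = if z ∈ Z then 0 else meromorphicOrderAt f z) ∧
      ∀ z, 0 ≤ meromorphicOrderAt f z →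
        f =ᶠ[𝓝 z] fun w => (∏ a ∈ Z, e a w ^ mult f a) * v w := by
  classical
  set q : ℂ → ℂ := fun w => ∏ a ∈ Z, e a w ^ mult f a with hq
  have hqm : ∀ z, MeromorphicAt q z := fun z =>
    MeromorphicAt.fun_prod fun a ha => ((he a ha z).meromorphicAt).fun_zpow _
  have hqo := order_prod_zpow he ho (mult f)
  have hfm : ∀ z, MeromorphicAt f z := fun z => (hf (Set.mem_univ z)).meromorphicAt
  have hm : MeromorphicOn (f * q⁻¹) Set.univ := fun z _ => (hfm z).mul (hqm z).inv
  set v := toMeromorphicNFOn (f * q⁻¹) Set.univ with hv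
  have hvN : MeromorphicNFOn v Set.univ := meromorphicNFOn_toMeromorphicNFOn _ _
  have hvo : ∀ z, meromorphicOrderAt v z = if z ∈ Z then 0 else meromorphicOrderAt f z := by
    intro z
    rw [hv, meromorphicOrderAt_toMeromorphicNFOn hm (Set.mem_univ z),
      meromorphicOrderAt_mul (hfm z) (hqm z).inv, meromorphicOrderAt_inv, hqo z]
    split_ifs with h
    · rw [coe_mult (hfin z)]
      norm_cast
      simp
    · simp
  refine ⟨v, hvN, hvo, fun z hz => ?_⟩
  have hfa := ((hf (Set.mem_univ z)).meromorphicOrderAt_nonneg_iff_analyticAt).1 hz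
  have hva : AnalyticAt ℂ v z := by
    refine ((hvN (Set.mem_univ z)).meromorphicOrderAt_nonneg_iff_analyticAt).1 ?_
    rw [hvo]; split_ifs <;> simp [hz]
  have hne : ∀ a ∈ Z, ∀ w, w ≠ a → e a w ≠ 0 := by
    intro a ha w hw
    rw [← (he a ha w).meromorphicNFAt.meromorphicOrderAt_eq_zero_iff, ho a ha w, if_neg hw]
  have hqa : AnalyticAt ℂ q z := by
    refine Finset.analyticAt_fun_prod _ fun a ha => ?_
    by_cases h : z = a
    · subst h
      refine AnalyticAt.fun_zpow_nonneg (he z ha z) ?_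
      rw [coe_mult (hfin z)] at hz
      exact_mod_cast hz
    · exact (he a ha z).fun_zpow (hne a ha z h)
  -- The normal form `v` agrees with the quotient only off `z`. Both sides are continuous at `z`, so
  -- the identity extends across it.
  refine (ContinuousAt.eventuallyEq_nhds_iff_eventuallyEq_nhdsNE hfa.continuousAt
    (hqa.fun_mul hva).continuousAt).1 ?_
  have hq0 : ∀ᶠ w in 𝓝[≠] z, q w ≠ 0 := by
    refine (meromorphicOrderAt_ne_top_iff_eventually_ne_zero (hqm z)).1 ?_
    rw [hqo]; split_ifs <;> simp
  filter_upwards [hq0, hm.toMeromorphicNFOn_eq_self_on_nhdsNE (Set.mem_univ z)] with w h1 h2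
  rw [hv, h2]
  simp [mul_comm (f w), h1]

lemma logDeriv_factor (he : ∀ a ∈ Z, ∀ z, AnalyticAt ℂ (e a) z) {v : ℂ → ℂ} {n : ℂ → ℤ} {z : ℂ}
    (hez : ∀ a ∈ Z, e a z ≠ 0) (hva : AnalyticAt ℂ v z) (hv0 : v z ≠ 0)
    (h : f =ᶠ[𝓝 z] fun w => (∏ a ∈ Z, e a w ^ n a) * v w) :
    logDeriv f z = (∑ a ∈ Z, (n a : ℂ) * logDeriv (e a) z) + logDeriv v z := by
  have hd : ∀ a ∈ Z, DifferentiableAt ℂ (fun w => e a w ^ n a) z := fun a ha =>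
    ((he a ha z).fun_zpow (hez a ha)).differentiableAt
  have hn : ∀ a ∈ Z, e a z ^ n a ≠ 0 := fun a ha => zpow_ne_zero _ (hez a ha)
  rw [(logDeriv_congr_nhds h).eq_of_nhds, logDeriv_mul (f := fun w => ∏ a ∈ Z, e a w ^ n a) z
    (Finset.prod_ne_zero_iff.2 hn) hv0 (.fun_finsetProd hd) hva.differentiableAt, logDeriv_prod (f := fun a w => e a w ^ n a) hn hd]
  congr 1
  exact Finset.sum_congr rfl fun a ha => logDeriv_fun_zpow (he a ha z).differentiableAt _

end Factor

end Yosida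

/-! ### Zero counting and area bounds in a single disc -/

namespace Yosida

open MeasureTheory Metric Set in
-- In polar coordinates about `a` the Jacobian `r` cancels the singularity `1/r`.
lemma lintegral_inv_sub_le (a : ℂ) {ρ : ℝ} (hρ : 0 ≤ ρ) :
    ∫⁻ z in closedBall a ρ, ‖(z - a)⁻¹‖ₑ ≤ ENNReal.ofReal (2 * Real.pi * ρ) := by
  have h1 : ∫⁻ z in closedBall a ρ, ‖(z - a)⁻¹‖ₑ
      = ∫⁻ z, (closedBall (0 : ℂ) ρ).indicator (fun z => ‖z⁻¹‖ₑ) z := by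
    rw [← lintegral_indicator isClosed_closedBall.measurableSet,
      ← lintegral_sub_right_eq_self (fun z => (closedBall (0 : ℂ) ρ).indicator (fun z => ‖z⁻¹‖ₑ) z) a]
    refine lintegral_congr fun z => ?_
    simp only [indicator, mem_closedBall, dist_eq_norm, sub_zero]
  rw [h1, ← Complex.lintegral_comp_polarCoord_symm]
  have h2 : ∀ p ∈ polarCoord.target, ENNReal.ofReal p.1 •
      (closedBall (0 : ℂ) ρ).indicator (fun z => ‖z⁻¹‖ₑ) (Complex.polarCoord.symm p)
      ≤ (Ioc 0 ρ ×ˢ Ioo (-Real.pi) Real.pi).indicator (fun _ => (1 : ENNReal)) p := by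
    intro p hp
    rw [polarCoord_target] at hp
    have hp1 : 0 < p.1 := hp.1
    have hn : ‖Complex.polarCoord.symm p‖ = p.1 := by
      rw [Complex.norm_polarCoord_symm, abs_of_pos hp1]
    by_cases hle : p.1 ≤ ρ
    · have hm : p ∈ Ioc 0 ρ ×ˢ Ioo (-Real.pi) Real.pi := ⟨⟨hp1, hle⟩, hp.2⟩
      rw [indicator_of_mem (by rwa [mem_closedBall_zero_iff, hn]), indicator_of_mem hm,
        smul_eq_mul, ← ofReal_norm, norm_inv, hn, ← ENNReal.ofReal_mul hp1.le,
        mul_inv_cancel₀ hp1.ne', ENNReal.ofReal_one]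
    · rw [indicator_of_notMem (by rwa [mem_closedBall_zero_iff, hn])]
      simp
  refine (setLIntegral_mono' polarCoord.open_target.measurableSet h2).trans ?_
  refine (setLIntegral_le_lintegral _ _).trans ?_
  rw [lintegral_indicator_const (measurableSet_Ioc.prod measurableSet_Ioo), one_mul,
    Measure.volume_eq_prod, Measure.prod_prod, Real.volume_Ioc, Real.volume_Ioo,
    ← ENNReal.ofReal_mul (by linarith)]
  apply ENNReal.ofReal_le_ofReal
  linarith

open MeasureTheory Metric Set in
/-- A holomorphic function which is bounded on a disc, and bounded below near the boundary of a
smaller disc, has few zeros and a logarithmic derivative with small area integral. -/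
theorem disc_bounds {g : ℂ → ℂ} (hg : MeromorphicNFOn g Set.univ)
    (hfin : ∀ z, meromorphicOrderAt g z ≠ ⊤) {h : ℂ} {ρ M κ : ℝ} (hρ : 0 < ρ) (hM0 : 0 < M)
    (han : ∀ z ∈ closedBall h (2 * ρ), AnalyticAt ℂ g z)
    (hM : ∀ z ∈ closedBall h (2 * ρ), ‖g z‖ ≤ M)
    (hκ : ∀ z ∈ closedBall h ρ, ρ / 2 ≤ ‖z - h‖ → M ≤ κ * ‖g z‖) :
    (∀ Z : Finset ℂ, (∀ a ∈ Z, a ∈ closedBall h ρ) → ∑ a ∈ Z, |(mult g a : ℝ)| ≤ κ) ∧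
      ∫⁻ z in closedBall h (ρ / 2), ‖logDeriv g z‖ₑ ≤ ENNReal.ofReal (10 * κ * ρ) := by
  classical
  have hsub : closedBall h ρ ⊆ closedBall h (2 * ρ) := closedBall_subset_closedBall (by linarith)
  have hsp : ∀ z ∈ sphere h ρ, z ∈ closedBall h ρ ∧ ρ / 2 ≤ ‖z - h‖ := fun z hz =>
    ⟨sphere_subset_closedBall hz, by rw [mem_sphere_iff_norm] at hz; linarith⟩
  have hκ0 : 0 < κ := by
    have h0 : h + ρ ∈ sphere h ρ := by simp [mem_sphere_iff_norm, abs_of_pos hρ]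
    have := hκ _ (hsp _ h0).1 (hsp _ h0).2
    by_contra hc
    have := mul_nonpos_of_nonpos_of_nonneg (not_lt.1 hc) (norm_nonneg (g (h + ρ)))
    linarith
  have hg0 : ∀ z ∈ closedBall h ρ, ρ / 2 ≤ ‖z - h‖ → g z ≠ 0 := by
    intro z hz hz' h0
    have := hκ z hz hz'
    rw [h0] at this
    simp at this
    linarith
  have hmn : ∀ a ∈ closedBall h ρ, 0 ≤ mult g a := by
    intro a ha
    have := (han a (hsub ha)).meromorphicOrderAt_nonneg
    rw [coe_mult (hfin a)] at this
    exact_mod_cast this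
  set W := (finite_mult_ne_zero hg h ρ).toFinset with hW
  have hWmem : ∀ a, a ∈ W ↔ a ∈ closedBall h ρ ∧ mult g a ≠ 0 := by simp [hW]
  have hz0 : ∀ a ∈ closedBall h ρ, mult g a ≠ 0 → g a = 0 := by
    intro a ha hm
    by_contra hc
    have hc := ((hg (mem_univ a)).meromorphicOrderAt_eq_zero_iff).2 hc
    exact hm (by simp [mult, hc])
  -- The lower bound `hκ` excludes zeros from the outer annulus, so they all keep distance `ρ/2`
  -- from the circle of radius `ρ`.
  have hWball : ∀ a ∈ W, ‖a - h‖ < ρ / 2 := by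
    intro a ha
    obtain ⟨h1, h2⟩ := (hWmem a).1 ha
    by_contra hc
    exact hg0 a h1 (not_lt.1 hc) (hz0 a h1 h2)
  have he : ∀ a ∈ W, ∀ z, AnalyticAt ℂ ((fun a w => w - a) a) z := fun a _ z => by fun_prop
  have ho : ∀ a ∈ W, ∀ z, meromorphicOrderAt ((fun a w => w - a) a) z = if z = a then 1 else 0 := by
    intro a _ z
    split_ifs with hza
    · subst hza
      exact meromorphicOrderAt_id_sub_const
    · exact ((he a ‹_› z).meromorphicNFAt.meromorphicOrderAt_eq_zero_iff).2 (sub_ne_zero.2 hza)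
  obtain ⟨v, hvN, hvo, hveq⟩ := exists_factor hg hfin he ho
  have hv0 : ∀ z ∈ closedBall h ρ, meromorphicOrderAt v z = 0 := by
    intro z hz
    rw [hvo]
    split_ifs with hzW
    · rfl
    · rw [hWmem] at hzW
      rw [coe_mult (hfin z)]
      have : mult g z = 0 := by tauto
      simp [this]
  have hva : ∀ z ∈ closedBall h ρ, AnalyticAt ℂ v z := fun z hz =>
    ((hvN (mem_univ z)).meromorphicOrderAt_nonneg_iff_analyticAt).1 (hv0 z hz).ge
  have hvn : ∀ z ∈ closedBall h ρ, v z ≠ 0 := fun z hz =>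
    ((hvN (mem_univ z)).meromorphicOrderAt_eq_zero_iff).1 (hv0 z hz)
  have hV : ∀ z ∈ closedBall h ρ, AnalyticAt ℂ (logDeriv v) z := fun z hz =>
    (hva z hz).deriv.div (hva z hz) (hvn z hz)
  have hlog : ∀ z ∈ closedBall h ρ, g z ≠ 0 →
      logDeriv g z = (∑ a ∈ W, (mult g a : ℂ) * (z - a)⁻¹) + logDeriv v z := by
    intro z hz hgz
    have hzW : z ∉ W := fun hzW => hgz (hz0 z hz ((hWmem z).1 hzW).2)
    rw [logDeriv_factor he (fun a ha => sub_ne_zero.2 fun (hza : z = a) => hzW (hza ▸ ha)) (hva z hz)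
      (hvn z hz) (hveq z (han z (hsub hz)).meromorphicOrderAt_nonneg)]
    congr 1
    refine Finset.sum_congr rfl fun a ha => ?_
    simp [logDeriv_apply]
  -- Cauchy's estimate on the disc of radius `ρ` about `z`, which lies in the disc of radius `2ρ`
  -- about `h`, gives `|g'| ≤ M/ρ`, while `|g| ≥ M/κ` on the circle.
  have hgd : ∀ z ∈ sphere h ρ, ‖logDeriv g z‖ ≤ κ / ρ := by
    intro z hz
    have hd : ‖deriv g z‖ ≤ M / ρ := by
      have hs : closedBall z ρ ⊆ closedBall h (2 * ρ) := by
        refine closedBall_subset_closedBall' ?_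
        rw [mem_sphere.1 hz]; linarith
      refine Complex.norm_deriv_le_of_forall_mem_sphere_norm_le hρ ?_
        (fun w hw => hM w (hs (sphere_subset_closedBall hw)))
      refine DifferentiableOn.diffContOnCl ?_
      rw [closure_ball z hρ.ne']
      exact fun w hw => (han w (hs hw)).differentiableAt.differentiableWithinAt
    have hgz := hκ z (hsp z hz).1 (hsp z hz).2
    have hgz0 : 0 < ‖g z‖ := norm_pos_iff.2 (hg0 z (hsp z hz).1 (hsp z hz).2)
    rw [logDeriv_apply, norm_div, div_le_div_iff₀ hgz0 hρ]
    calc ‖deriv g z‖ * ρ ≤ M / ρ * ρ := by gcongr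
      _ = M := by field_simp
      _ ≤ _ := hgz
  set N : ℝ := ∑ a ∈ W, (mult g a : ℝ) with hN
  -- The argument principle; with the bound `κ/ρ` on the circle it yields `N ≤ κ`.
  have hNint : (∮ z in C(h, ρ), logDeriv g z) = 2 * Real.pi * Complex.I * N := by
    rw [circleIntegral.integral_congr hρ.le
      (g := fun z => (∑ a ∈ W, (mult g a : ℂ) * (z - a)⁻¹) + logDeriv v z)
      (fun z hz => hlog z (hsp z hz).1 (hg0 z (hsp z hz).1 (hsp z hz).2))]
    have hci : ∀ a ∈ W, CircleIntegrable (fun z => (mult g a : ℂ) * (z - a)⁻¹) h ρ := by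
      intro a ha
      refine ContinuousOn.circleIntegrable hρ.le fun z hz => ?_
      have : z - a ≠ 0 := by
        intro h0
        have := hWball a ha
        rw [← sub_eq_zero.1 h0] at this
        have := (hsp z hz).2
        linarith
      exact ContinuousAt.continuousWithinAt (by fun_prop (disch := assumption))
    rw [circleIntegral.integral_add (CircleIntegrable.fun_sum W hci)
      (ContinuousOn.circleIntegrable hρ.le fun z hz =>
        (hV z (hsp z hz).1).continuousAt.continuousWithinAt),
      circleIntegral.integral_fun_sum hci]
    have h1 : (∮ z in C(h, ρ), logDeriv v z) = 0 :=
      Complex.circleIntegral_eq_zero_of_differentiable_on_off_countable hρ.le countable_empty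
        (fun z hz => (hV z hz).continuousAt.continuousWithinAt)
        (fun z hz => (hV z (ball_subset_closedBall hz.1)).differentiableAt)
    have h2 : ∀ a ∈ W, (∮ z in C(h, ρ), (mult g a : ℂ) * (z - a)⁻¹)
        = 2 * Real.pi * Complex.I * (mult g a : ℂ) := by
      intro a ha
      rw [circleIntegral.integral_const_mul, circleIntegral.integral_sub_inv_of_mem_ball]
      · ring
      · rw [mem_ball_iff_norm]; linarith [hWball a ha]
    rw [h1, Finset.sum_congr rfl h2, ← Finset.mul_sum, hN]
    push_cast
    ring
  have hN0 : 0 ≤ N := Finset.sum_nonneg fun a ha => by exact_mod_cast hmn a ((hWmem a).1 ha).1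
  have hNκ : N ≤ κ := by
    have := circleIntegral.norm_integral_le_of_norm_le_const hρ.le hgd
    rw [hNint] at this
    simp only [norm_mul, Complex.norm_real, Complex.norm_I, Complex.norm_ofNat, mul_one,
      Real.norm_eq_abs, abs_of_pos Real.pi_pos, abs_of_nonneg hN0] at this
    have h3 : 2 * Real.pi * ρ * (κ / ρ) = 2 * Real.pi * κ := by field_simp
    rw [h3] at this
    exact le_of_mul_le_mul_left this (by positivity)
  refine ⟨fun Z hZ => ?_, ?_⟩
  · refine le_trans ?_ hNκ
    calc ∑ a ∈ Z, |(mult g a : ℝ)| = ∑ a ∈ Z, (mult g a : ℝ) :=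
          Finset.sum_congr rfl fun a ha => abs_of_nonneg (by exact_mod_cast hmn a (hZ a ha))
      _ = ∑ a ∈ Z with mult g a ≠ 0, (mult g a : ℝ) := by
          rw [Finset.sum_filter]
          refine Finset.sum_congr rfl fun a _ => ?_
          split_ifs with hx <;> simp_all
      _ ≤ N := by
          refine Finset.sum_le_sum_of_subset_of_nonneg (fun a ha => ?_) fun a ha _ => ?_
          · rw [Finset.mem_filter] at ha
            exact (hWmem a).2 ⟨hZ a ha.1, ha.2⟩
          · exact_mod_cast hmn a ((hWmem a).1 ha).1
  -- Maximum principle for the holomorphic part of `g'/g`. On the circle `g'/g` contributes `κ/ρ`,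
  -- and the `N ≤ κ` polar terms contribute at most `2/ρ` each.
  have hVb : ∀ z ∈ closedBall h ρ, ‖logDeriv v z‖ ≤ 3 * κ / ρ := by
    have hfr : ∀ z ∈ frontier (ball h ρ), ‖logDeriv v z‖ ≤ 3 * κ / ρ := by
      rw [frontier_ball h hρ.ne']
      intro z hz
      have := hlog z (hsp z hz).1 (hg0 z (hsp z hz).1 (hsp z hz).2)
      rw [← sub_eq_iff_eq_add'] at this
      rw [← this]
      refine (norm_sub_le _ _).trans ?_
      have hs : ‖∑ a ∈ W, (mult g a : ℂ) * (z - a)⁻¹‖ ≤ N * (2 / ρ) := by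
        rw [hN, Finset.sum_mul]
        refine norm_sum_le_of_le _ fun a ha => ?_
        have hm : (0 : ℝ) ≤ mult g a := by exact_mod_cast hmn a ((hWmem a).1 ha).1
        rw [norm_mul, Complex.norm_intCast, abs_of_nonneg hm, norm_inv]
        refine mul_le_mul_of_nonneg_left ?_ hm
        rw [inv_le_comm₀ _ (by positivity), inv_div]
        · have h4 : ‖z - h‖ ≤ ‖z - a‖ + ‖a - h‖ := by simpa using norm_add_le (z - a) (a - h)
          have := hWball a ha
          rw [mem_sphere_iff_norm] at hz
          linarith
        · refine norm_pos_iff.2 (sub_ne_zero.2 ?_)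
          rintro rfl
          have := hWball _ ha
          rw [mem_sphere_iff_norm] at hz
          linarith
      have h5 : N * (2 / ρ) ≤ κ * (2 / ρ) := by gcongr
      have h6 := hgd z hz
      have h7 : κ / ρ + κ * (2 / ρ) = 3 * κ / ρ := by ring
      linarith
    intro z hz
    refine Complex.norm_le_of_forall_mem_frontier_norm_le isBounded_ball ?_ hfr
      (by rwa [closure_ball h hρ.ne'])
    refine DifferentiableOn.diffContOnCl ?_
    rw [closure_ball h hρ.ne']
    exact fun w hw => (hV w hw).differentiableAt.differentiableWithinAt
  have hpt : ∀ z ∈ closedBall h (ρ / 2), ‖logDeriv g z‖ₑ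
      ≤ (∑ a ∈ W, ENNReal.ofReal (mult g a : ℝ) * ‖(z - a)⁻¹‖ₑ) + ENNReal.ofReal (3 * κ / ρ) := by
    intro z hz
    have hz' : z ∈ closedBall h ρ := closedBall_subset_closedBall (by linarith) hz
    -- At a zero of `g` the quotient `g'/g` takes the default value `0`.
    by_cases hgz : g z = 0
    · simp [logDeriv_apply, hgz]
    · rw [hlog z hz' hgz]
      refine (enorm_add_le _ _).trans (add_le_add ((enorm_sum_le _ _).trans ?_) ?_)
      · refine Finset.sum_le_sum fun a ha => ?_
        have hm : (0 : ℝ) ≤ mult g a := by exact_mod_cast hmn a ((hWmem a).1 ha).1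
        rw [enorm_mul, ← ofReal_norm (mult g a : ℂ), Complex.norm_intCast, abs_of_nonneg hm]
      · rw [← ofReal_norm]
        exact ENNReal.ofReal_le_ofReal (hVb z hz')
  refine (setLIntegral_mono' isClosed_closedBall.measurableSet hpt).trans ?_
  rw [lintegral_add_right _ measurable_const, lintegral_finsetSum _ (fun a _ => by fun_prop)]
  have hone : ∀ a ∈ W, ∫⁻ z in closedBall h (ρ / 2), ENNReal.ofReal (mult g a : ℝ) * ‖(z - a)⁻¹‖ₑ
      ≤ ENNReal.ofReal ((mult g a : ℝ) * (2 * Real.pi * ρ)) := by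
    intro a ha
    have hm : (0 : ℝ) ≤ mult g a := by exact_mod_cast hmn a ((hWmem a).1 ha).1
    rw [lintegral_const_mul _ (by fun_prop), ENNReal.ofReal_mul hm]
    refine mul_le_mul_right ((lintegral_mono_set ?_).trans (lintegral_inv_sub_le a hρ.le)) _
    refine closedBall_subset_closedBall' ?_
    rw [dist_comm, dist_eq_norm]
    linarith [hWball a ha]
  refine (add_le_add (Finset.sum_le_sum hone) le_rfl).trans ?_
  rw [← ENNReal.ofReal_sum_of_nonneg, setLIntegral_const, ← Finset.sum_mul, ← hN,
    Complex.volume_closedBall]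
  · rw [← ENNReal.ofReal_pow (by positivity), ← ENNReal.ofReal_coe_nnreal,
      ← ENNReal.ofReal_mul (by positivity), ← ENNReal.ofReal_mul (by positivity),
      ← ENNReal.ofReal_add (by positivity) (by positivity)]
    refine ENNReal.ofReal_le_ofReal ?_
    -- The polar terms contribute at most `2πκρ` and the holomorphic part `(3/4)πκρ`; the sum
    -- `(11/4)πκρ` is below `10κρ`.
    have e1 : 3 * κ / ρ * ((ρ / 2) ^ 2 * (NNReal.pi : ℝ)) = 3 / 4 * Real.pi * κ * ρ := by
      rw [NNReal.coe_real_pi]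
      field_simp
      ring
    rw [e1]
    have e2 : N * (2 * Real.pi * ρ) ≤ κ * (2 * Real.pi * ρ) := by gcongr
    have e3 : Real.pi * (κ * ρ) ≤ 3.15 * (κ * ρ) := by
      gcongr
      exact Real.pi_lt_d2.le
    nlinarith [mul_pos hκ0 hρ]
  · intro a ha
    have hm : (0 : ℝ) ≤ mult g a := by exact_mod_cast hmn a ((hWmem a).1 ha).1
    positivity

end Yosida

/-! ### Chordal metric and inversion of the sphere -/

namespace Yosida

lemma chordal_coe (a b : ℂ) : chordal (a : OnePoint ℂ) (b : OnePoint ℂ)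
    = ‖a - b‖ / (Real.sqrt (1 + ‖a‖ ^ 2) * Real.sqrt (1 + ‖b‖ ^ 2)) := rfl

lemma chordal_coe_infty (a : ℂ) : chordal (a : OnePoint ℂ) OnePoint.infty
    = 1 / Real.sqrt (1 + ‖a‖ ^ 2) := rfl

lemma chordal_infty_coe (a : ℂ) : chordal OnePoint.infty (a : OnePoint ℂ)
    = 1 / Real.sqrt (1 + ‖a‖ ^ 2) := rfl

lemma chordal_infty_infty : chordal OnePoint.infty OnePoint.infty = 0 := rfl

lemma sqrt_one_add_sq_pos (x : ℝ) : 0 < Real.sqrt (1 + x ^ 2) := Real.sqrt_pos.2 (by positivity)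

/-- The length of the vector `(1, x)` is a 1-Lipschitz function of `x`. -/
lemma sqrt_one_add_sq_sub_le {x y d : ℝ} (hd : |x - y| ≤ d) :
    Real.sqrt (1 + x ^ 2) - Real.sqrt (1 + y ^ 2) ≤ d := by
  have hd0 : 0 ≤ d := (abs_nonneg _).trans hd
  rw [sub_le_iff_le_add, Real.sqrt_le_left (by positivity)]
  have h1 := Real.sq_sqrt (show 0 ≤ 1 + y ^ 2 by positivity)
  have h2 : |y| ≤ Real.sqrt (1 + y ^ 2) := Real.abs_le_sqrt (by linarith)
  have h3 : x ^ 2 ≤ (|y| + d) ^ 2 := by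
    rw [← sq_abs x]
    have := abs_sub_abs_le_abs_sub x y
    exact pow_le_pow_left₀ (abs_nonneg x) (by linarith) 2
  nlinarith [sq_abs y]

/-- The chordal distance to `∞` is a Lipschitz function. -/
lemma abs_chordal_infty_sub_le (x y : OnePoint ℂ) :
    |chordal x OnePoint.infty - chordal y OnePoint.infty| ≤ chordal x y := by
  induction x using OnePoint.rec with
  | infty =>
    induction y using OnePoint.rec with
    | infty => simp [chordal_infty_infty]
    | coe b =>
      rw [chordal_infty_infty, chordal_coe_infty, chordal_infty_coe, zero_sub, abs_neg,
        abs_of_nonneg (by positivity)]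
  | coe a =>
    induction y using OnePoint.rec with
    | infty =>
      rw [chordal_infty_infty, chordal_coe_infty, sub_zero, abs_of_nonneg (by positivity)]
    | coe b =>
      rw [chordal_coe_infty, chordal_coe_infty, chordal_coe]
      have hA := sqrt_one_add_sq_pos ‖a‖
      have hB := sqrt_one_add_sq_pos ‖b‖
      have h1 := sqrt_one_add_sq_sub_le (abs_norm_sub_norm_le a b)
      have h2 := sqrt_one_add_sq_sub_le (x := ‖b‖) (y := ‖a‖) (d := ‖a - b‖)
        (by rw [abs_sub_comm]; exact abs_norm_sub_norm_le a b)
      rw [div_sub_div _ _ hA.ne' hB.ne', abs_div, abs_of_pos (mul_pos hA hB)]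
      gcongr
      rw [abs_le]
      constructor <;> linarith

lemma exists_coe_of_le_chordal {x : OnePoint ℂ} {t : ℝ} (ht : 0 < t)
    (h : t ≤ chordal x OnePoint.infty) : ∃ a : ℂ, x = (a : OnePoint ℂ) ∧ ‖a‖ ≤ 1 / t := by
  induction x using OnePoint.rec with
  | infty => rw [chordal_infty_infty] at h; linarith
  | coe a =>
    refine ⟨a, rfl, ?_⟩
    rw [chordal_coe_infty, le_div_comm₀ ht (sqrt_one_add_sq_pos _)] at h
    exact (Real.le_sqrt_of_sq_le (by linarith)).trans h

/-- On bounded sets the chordal metric controls the Euclidean one; this turns spherical convergence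
into ordinary uniform convergence where the limit is finite. -/
lemma norm_sub_le_chordal {a b : ℂ} {W : ℝ} (ha : ‖a‖ ≤ W) (hb : ‖b‖ ≤ W) :
    ‖a - b‖ ≤ (1 + W ^ 2) * chordal (a : OnePoint ℂ) (b : OnePoint ℂ) := by
  rw [chordal_coe]
  have hA := sqrt_one_add_sq_pos ‖a‖
  have hB := sqrt_one_add_sq_pos ‖b‖
  have h1 : Real.sqrt (1 + ‖a‖ ^ 2) * Real.sqrt (1 + ‖b‖ ^ 2) ≤ 1 + W ^ 2 := by
    calc _ ≤ Real.sqrt (1 + W ^ 2) * Real.sqrt (1 + W ^ 2) := by gcongr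
      _ = _ := Real.mul_self_sqrt (by positivity)
  rw [mul_div_assoc', le_div_iff₀ (mul_pos hA hB), mul_comm]
  gcongr

open Classical in
/-- The inversion of the Riemann sphere. -/
noncomputable def sphereInv : OnePoint ℂ → OnePoint ℂ
  | OnePoint.some a => if a = 0 then OnePoint.infty else ((a⁻¹ : ℂ) : OnePoint ℂ)
  | OnePoint.infty => ((0 : ℂ) : OnePoint ℂ)

lemma sphereInv_infty : sphereInv OnePoint.infty = ((0 : ℂ) : OnePoint ℂ) := rfl

lemma sphereInv_coe {a : ℂ} (ha : a ≠ 0) :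
    sphereInv (a : OnePoint ℂ) = ((a⁻¹ : ℂ) : OnePoint ℂ) := if_neg ha

lemma sphereInv_zero : sphereInv ((0 : ℂ) : OnePoint ℂ) = OnePoint.infty := if_pos rfl

lemma sphereInv_sphereInv (x : OnePoint ℂ) : sphereInv (sphereInv x) = x := by
  induction x using OnePoint.rec with
  | infty => rw [sphereInv_infty, sphereInv_zero]
  | coe a =>
    by_cases ha : a = 0
    · subst ha; rw [sphereInv_zero, sphereInv_infty]
    · rw [sphereInv_coe ha, sphereInv_coe (inv_ne_zero ha), inv_inv]

lemma sqrt_one_add_inv_sq {a : ℂ} (ha : a ≠ 0) :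
    Real.sqrt (1 + ‖a⁻¹‖ ^ 2) = Real.sqrt (1 + ‖a‖ ^ 2) / ‖a‖ := by
  have : 0 < ‖a‖ := norm_pos_iff.2 ha
  rw [← Real.sqrt_sq this.le, ← Real.sqrt_div (by positivity), Real.sqrt_sq this.le, norm_inv]
  congr 1
  field_simp
  ring

/-- Inversion is a rotation of the sphere: the factors `|a|` and `|b|` coming from numerator and
denominator cancel. Poles of `f` can therefore be treated as zeros of `1/f`. -/
lemma chordal_sphereInv (x y : OnePoint ℂ) : chordal (sphereInv x) (sphereInv y) = chordal x y := by
  induction x using OnePoint.rec with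
  | infty =>
    induction y using OnePoint.rec with
    | infty => simp [sphereInv_infty, chordal_coe, chordal_infty_infty]
    | coe b =>
      by_cases hb : b = 0
      · subst hb; simp [sphereInv_infty, sphereInv_zero, chordal_infty_coe, chordal_coe_infty]
      · have : 0 < ‖b‖ := norm_pos_iff.2 hb
        rw [sphereInv_infty, sphereInv_coe hb, chordal_coe, chordal_infty_coe,
          sqrt_one_add_inv_sq hb]
        have := sqrt_one_add_sq_pos ‖b‖
        simp
        field_simp
  | coe a =>
    by_cases ha : a = 0
    · subst ha
      induction y using OnePoint.rec with
      | infty => simp [sphereInv_infty, sphereInv_zero, chordal_infty_coe, chordal_coe_infty]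
      | coe b =>
        by_cases hb : b = 0
        · subst hb; simp [sphereInv_zero, chordal_infty_infty, chordal_coe]
        · have : 0 < ‖b‖ := norm_pos_iff.2 hb
          rw [sphereInv_zero, sphereInv_coe hb, chordal_coe, chordal_infty_coe,
            sqrt_one_add_inv_sq hb]
          have := sqrt_one_add_sq_pos ‖b‖
          simp
    · have ha' : 0 < ‖a‖ := norm_pos_iff.2 ha
      have hA := sqrt_one_add_sq_pos ‖a‖
      induction y using OnePoint.rec with
      | infty =>
        rw [sphereInv_infty, sphereInv_coe ha, chordal_coe, chordal_coe_infty,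
          sqrt_one_add_inv_sq ha]
        simp
        field_simp
      | coe b =>
        by_cases hb : b = 0
        · subst hb
          rw [sphereInv_zero, sphereInv_coe ha, chordal_coe, chordal_coe_infty,
            sqrt_one_add_inv_sq ha]
          simp
        · have hb' : 0 < ‖b‖ := norm_pos_iff.2 hb
          have hB := sqrt_one_add_sq_pos ‖b‖
          rw [sphereInv_coe ha, sphereInv_coe hb, chordal_coe, chordal_coe,
            sqrt_one_add_inv_sq ha, sqrt_one_add_inv_sq hb, inv_sub_inv ha hb, norm_div, norm_mul,
            norm_sub_rev b a]
          field_simp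

lemma toSphere_of_nonneg {F : ℂ → ℂ} {z : ℂ} (h : 0 ≤ meromorphicOrderAt F z) :
    toSphere F z = (F z : OnePoint ℂ) := if_neg (not_lt.2 h)

lemma toSphere_of_neg {F : ℂ → ℂ} {z : ℂ} (h : meromorphicOrderAt F z < 0) :
    toSphere F z = OnePoint.infty := if_pos h

/-- Normal form gives `F` the value `0` at its poles, so the pointwise inverse is correctly `0`
there. Finite order excludes a locally vanishing `F`, whose pointwise inverse is again `0` and not
`∞`. -/
lemma toSphere_inv {F : ℂ → ℂ} {z : ℂ} (hF : MeromorphicNFAt F z)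
    (h : meromorphicOrderAt F z ≠ ⊤) : toSphere F⁻¹ z = sphereInv (toSphere F z) := by
  have hi : meromorphicOrderAt F⁻¹ z = ((-mult F z : ℤ) : WithTop ℤ) := by
    rw [meromorphicOrderAt_inv, coe_mult h]; rfl
  have h1 := coe_mult h
  have h0 := hF.meromorphicOrderAt_eq_zero_iff
  rcases lt_trichotomy (mult F z) 0 with hm | hm | hm
  · rw [toSphere_of_neg (F := F) (by rw [h1]; exact_mod_cast hm),
      toSphere_of_nonneg (by rw [hi]; exact_mod_cast (by omega)), sphereInv_infty]
    have : F z = 0 := by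
      by_contra hc
      have := h0.2 hc
      rw [h1] at this
      norm_cast at this
      omega
    simp [this]
  · have hz : F z ≠ 0 := h0.1 (by rw [h1, hm]; rfl)
    rw [toSphere_of_nonneg (F := F) (by rw [h1]; exact_mod_cast hm.ge),
      toSphere_of_nonneg (by rw [hi]; exact_mod_cast (by omega)), sphereInv_coe hz]
    rfl
  · have : F z = 0 := by
      by_contra hc
      have := h0.2 hc
      rw [h1] at this
      norm_cast at this
      omega
    rw [toSphere_of_nonneg (F := F) (by rw [h1]; exact_mod_cast hm.le),
      toSphere_of_neg (by rw [hi]; exact_mod_cast (by omega)), this, sphereInv_zero]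

/-- At a pole `|F| → ∞`, so the chordal distance to `∞` tends to `0`. This one scalar function
carries all the continuity on the sphere that is needed. -/
lemma continuous_chordal_infty_toSphere {F : ℂ → ℂ} (hF : MeromorphicNFOn F Set.univ) :
    Continuous fun z => chordal (toSphere F z) OnePoint.infty := by
  rw [continuous_iff_continuousAt]
  intro z
  have hz := hF (Set.mem_univ z)
  have hev : ∀ᶠ w in 𝓝[≠] z, toSphere F w = (F w : OnePoint ℂ) := by
    filter_upwards [hz.meromorphicAt.eventually_analyticAt] with w hw
    exact toSphere_of_nonneg hw.meromorphicOrderAt_nonneg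
  rcases lt_or_ge (meromorphicOrderAt F z) 0 with hneg | hnn
  · have hne : Tendsto (fun w => chordal (toSphere F w) OnePoint.infty) (𝓝[≠] z) (𝓝 0) := by
      have h1 := tendsto_norm_cobounded_atTop.comp (tendsto_cobounded_of_meromorphicOrderAt_neg hneg)
      have h2 : Tendsto (fun w => (‖F w‖)⁻¹) (𝓝[≠] z) (𝓝 0) := tendsto_inv_atTop_zero.comp h1
      refine squeeze_zero' ?_ ?_ h2
      · filter_upwards [hev] with w hw
        rw [hw, chordal_coe_infty]; positivity
      · filter_upwards [hev, h1.eventually_gt_atTop 0] with w hw hw0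
        rw [hw, chordal_coe_infty, ← one_div]
        refine one_div_le_one_div_of_le hw0 (Real.le_sqrt_of_sq_le ?_)
        linarith
    rw [← continuousWithinAt_compl_self, ContinuousWithinAt, toSphere_of_neg hneg,
      chordal_infty_infty]
    exact hne
  · have hev' : ∀ᶠ w in 𝓝 z, toSphere F w = (F w : OnePoint ℂ) := by
      have := (hz.meromorphicOrderAt_nonneg_iff_analyticAt.1 hnn).eventually_analyticAt
      filter_upwards [this] with w hw
      exact toSphere_of_nonneg hw.meromorphicOrderAt_nonneg
    have hFc := (hz.meromorphicOrderAt_nonneg_iff_analyticAt.1 hnn).continuousAt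
    have : ContinuousAt (fun w => 1 / Real.sqrt (1 + ‖F w‖ ^ 2)) z :=
      ContinuousAt.div continuousAt_const (by fun_prop) (sqrt_one_add_sq_pos _).ne'
    refine this.congr ?_
    filter_upwards [hev'] with w hw
    rw [hw, chordal_coe_infty]

end Yosida

/-! ### Spherical limits of meromorphic functions -/

namespace Yosida

section Limit

variable {F : ℕ → ℂ → ℂ} {φ : ℂ → OnePoint ℂ}

/-- The limit `φ` is a priori an arbitrary map; continuity is inherited as a locally uniform limit
of continuous functions. -/
lemma continuous_chordal_infty_limit (hF : ∀ n, MeromorphicNFOn (F n) Set.univ)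
    (hφ : SphericalTendsto (fun n => toSphere (F n)) φ) :
    Continuous fun z => chordal (φ z) OnePoint.infty := by
  have : TendstoLocallyUniformly (fun n z => chordal (toSphere (F n) z) OnePoint.infty)
      (fun z => chordal (φ z) OnePoint.infty) atTop := by
    rw [tendstoLocallyUniformly_iff_forall_isCompact]
    intro K hK
    rw [Metric.tendstoUniformlyOn_iff]
    intro ε hε
    filter_upwards [hφ K hK ε hε] with n hn z hz
    rw [dist_comm, Real.dist_eq]
    exact (abs_chordal_infty_sub_le _ _).trans_lt (hn z hz)
  exact this.continuous (Frequently.of_forall fun n => continuous_chordal_infty_toSphere (hF n))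

open Metric in
/-- Near a point where the spherical limit is finite, the convergence is a uniform convergence of
bounded holomorphic functions. -/
lemma exists_analytic_limit (hF : ∀ n, MeromorphicNFOn (F n) Set.univ)
    (hφ : SphericalTendsto (fun n => toSphere (F n)) φ) {z₀ : ℂ} (hz₀ : φ z₀ ≠ OnePoint.infty) :
    ∃ ρ > 0, ∃ M > 0, ∃ ψ : ℂ → ℂ,
      (∀ᶠ n in atTop, ∀ z ∈ closedBall z₀ ρ, AnalyticAt ℂ (F n) z ∧ ‖F n z‖ ≤ M) ∧
      (∀ z ∈ closedBall z₀ ρ, φ z = (ψ z : OnePoint ℂ)) ∧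
      AnalyticOnNhd ℂ ψ (ball z₀ ρ) ∧
      TendstoUniformlyOn F ψ atTop (closedBall z₀ ρ) := by
  obtain ⟨w, hw⟩ := OnePoint.ne_infty_iff_exists.1 hz₀
  set t := chordal (φ z₀) OnePoint.infty with ht
  have ht0 : 0 < t := by
    rw [ht, ← hw, chordal_coe_infty]
    exact one_div_pos.2 (sqrt_one_add_sq_pos _)
  have hc := (continuous_chordal_infty_limit hF hφ).continuousAt.eventually
    (lt_mem_nhds (show t / 2 < chordal (φ z₀) OnePoint.infty by linarith))
  obtain ⟨ρ, hρ, hball⟩ := Metric.nhds_basis_closedBall.eventually_iff.1 hc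
  -- Continuity keeps `φ` at chordal distance more than `t/2` from `∞` on the ball, and
  -- approximation within `t/4` keeps `F n` at distance at least `t/4`; so `4/t` bounds both moduli.
  set M := 1 / (t / 4) with hM
  have hM0 : 0 < M := by positivity
  have hψ : ∀ z, ∃ a : ℂ, z ∈ closedBall z₀ ρ → φ z = (a : OnePoint ℂ) ∧ ‖a‖ ≤ M := by
    intro z
    by_cases hz : z ∈ closedBall z₀ ρ
    · obtain ⟨a, ha⟩ := exists_coe_of_le_chordal (t := t / 4) (by positivity)
        (by linarith [hball hz] : t / 4 ≤ chordal (φ z) OnePoint.infty)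
      exact ⟨a, fun _ => ha⟩
    · exact ⟨0, fun h => absurd h hz⟩
  choose ψ hψ using hψ
  have hev : ∀ᶠ n in atTop, ∀ z ∈ closedBall z₀ ρ, AnalyticAt ℂ (F n) z ∧ ‖F n z‖ ≤ M ∧
      toSphere (F n) z = (F n z : OnePoint ℂ) := by
    filter_upwards [hφ _ (isCompact_closedBall z₀ ρ) (t / 4) (by positivity)] with n hn z hz
    have h1 := (abs_le.1 ((abs_chordal_infty_sub_le _ _).trans (hn z hz).le)).1
    obtain ⟨a, ha, haM⟩ := exists_coe_of_le_chordal (t := t / 4) (by positivity)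
      (by linarith [hball hz] : t / 4 ≤ chordal (toSphere (F n) z) OnePoint.infty)
    have hnn : 0 ≤ meromorphicOrderAt (F n) z := by
      by_contra hc
      rw [toSphere_of_neg (not_le.1 hc)] at ha
      exact OnePoint.infty_ne_coe a ha
    have h2 := toSphere_of_nonneg hnn
    refine ⟨((hF n) (Set.mem_univ z)).meromorphicOrderAt_nonneg_iff_analyticAt.1 hnn, ?_, h2⟩
    rw [ha, OnePoint.coe_eq_coe] at h2
    rwa [← h2]
  have hunif : TendstoUniformlyOn F ψ atTop (closedBall z₀ ρ) := by
    rw [Metric.tendstoUniformlyOn_iff]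
    intro ε hε
    filter_upwards [hev, hφ _ (isCompact_closedBall z₀ ρ) (ε / (1 + M ^ 2)) (by positivity)]
      with n hn hn' z hz
    obtain ⟨-, h2, h3⟩ := hn z hz
    obtain ⟨h4, h5⟩ := hψ z hz
    have h6 := hn' z hz
    simp only [h3, h4] at h6
    rw [dist_comm, dist_eq_norm]
    refine (norm_sub_le_chordal h2 h5).trans_lt ?_
    rwa [lt_div_iff₀' (by positivity)] at h6
  refine ⟨ρ, hρ, M, hM0, ψ, ?_, fun z hz => (hψ z hz).1, ?_, hunif⟩
  · filter_upwards [hev] with n hn z hz using ⟨(hn z hz).1, (hn z hz).2.1⟩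
  · refine DifferentiableOn.analyticOnNhd ?_ isOpen_ball
    refine (hunif.mono ball_subset_closedBall).tendstoLocallyUniformlyOn.differentiableOn ?_
      isOpen_ball
    filter_upwards [hev] with n hn z hz
    exact (hn z (ball_subset_closedBall hz)).1.differentiableAt.differentiableWithinAt

open Metric in
/-- The identity theorem for spherical limits of meromorphic functions. -/
lemma eq_zero_of_eventually_eq_zero (hF : ∀ n, MeromorphicNFOn (F n) Set.univ)
    (hφ : SphericalTendsto (fun n => toSphere (F n)) φ) {z₀ : ℂ}
    (h : ∀ᶠ z in 𝓝 z₀, φ z = ((0 : ℂ) : OnePoint ℂ)) (z : ℂ) : φ z = ((0 : ℂ) : OnePoint ℂ) := by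
  set A : Set ℂ := {z | ∀ᶠ w in 𝓝 z, φ w = ((0 : ℂ) : OnePoint ℂ)} with hA
  have hopen : IsOpen A := isOpen_setOfPred_eventually_nhds
  have hclosed : IsClosed A := by
    refine isClosed_of_closure_subset fun x hx => ?_
    -- Points of `A` have distance `1` to `∞`, a closed condition. A limit point of `A` is thus not
    -- sent to `∞`, and the ordinary identity theorem applies near it.
    have hτ : chordal (φ x) OnePoint.infty = 1 := by
      have hcl : IsClosed {w | chordal (φ w) OnePoint.infty = 1} :=
        isClosed_eq (continuous_chordal_infty_limit hF hφ) continuous_const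
      refine closure_minimal (fun w hw => ?_) hcl hx
      have : φ w = ((0 : ℂ) : OnePoint ℂ) :=
        mem_of_mem_nhds (s := {w | φ w = ((0 : ℂ) : OnePoint ℂ)}) hw
      simp [this, chordal_coe_infty]
    have hx' : φ x ≠ OnePoint.infty := by
      intro hc
      rw [hc, chordal_infty_infty] at hτ
      exact zero_ne_one hτ
    obtain ⟨ρ, hρ, M, hM, ψ, -, hψ, han, -⟩ := exists_analytic_limit hF hφ hx'
    obtain ⟨y, hy, hyA⟩ := mem_closure_iff_nhds.1 hx _ (ball_mem_nhds x hρ)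
    have h0 : ψ =ᶠ[𝓝 y] 0 := by
      filter_upwards [hyA, isOpen_ball.mem_nhds hy] with w hw hwb
      rw [hψ w (ball_subset_closedBall hwb), OnePoint.coe_eq_coe] at hw
      exact hw
    have := han.eqOn_zero_of_preconnected_of_eventuallyEq_zero
      (convex_ball x ρ).isPreconnected hy h0
    filter_upwards [ball_mem_nhds x hρ] with w hw
    rw [hψ w (ball_subset_closedBall hw), this hw]
    rfl
  have huniv : A = Set.univ := IsClopen.eq_univ ⟨hclosed, hopen⟩ ⟨z₀, h⟩
  have hz : z ∈ A := huniv ▸ Set.mem_univ z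
  exact mem_of_mem_nhds (s := {w | φ w = ((0 : ℂ) : OnePoint ℂ)}) hz

open Metric in
-- Near `0` the limit is a holomorphic function that is not identically zero, so its zeros are
-- isolated and it has a positive minimum on a small closed annulus. Uniform convergence passes half
-- of that minimum on to `F n`.
lemma exists_bounds_of_ne_infty (hF : ∀ n, MeromorphicNFOn (F n) Set.univ)
    (hφ : SphericalTendsto (fun n => toSphere (F n)) φ)
    (hconst : ¬ ∀ z, φ z = ((0 : ℂ) : OnePoint ℂ)) (h0 : φ 0 ≠ OnePoint.infty) :
    ∃ ρ > 0, ρ ≤ 1 ∧ ∃ M > 0, ∃ κ > 0, ∀ᶠ n in atTop,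
      (∀ z ∈ closedBall (0 : ℂ) (2 * ρ), AnalyticAt ℂ (F n) z ∧ ‖F n z‖ ≤ M) ∧
      ∀ z ∈ closedBall (0 : ℂ) ρ, ρ / 2 ≤ ‖z‖ → M ≤ κ * ‖F n z‖ := by
  obtain ⟨ρ₁, hρ₁, M, hM, ψ, hev, hψ, han, hunif⟩ := exists_analytic_limit hF hφ h0
  have hne : ∀ᶠ z in 𝓝[≠] (0 : ℂ), ψ z ≠ 0 := by
    refine (han 0 (mem_ball_self hρ₁)).eventually_eq_zero_or_eventually_ne_zero.resolve_left ?_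
    intro hc
    refine hconst (eq_zero_of_eventually_eq_zero hF hφ (z₀ := 0) ?_)
    filter_upwards [hc, ball_mem_nhds 0 hρ₁] with w hw hwb
    rw [hψ w (ball_subset_closedBall hwb), hw]
  rw [eventually_nhdsWithin_iff] at hne
  obtain ⟨ρ₂, hρ₂, hball⟩ := Metric.nhds_basis_closedBall.eventually_iff.1 hne
  set ρ := min 1 (min ρ₂ (ρ₁ / 4)) with hρdef
  have hρ : 0 < ρ := by positivity
  have hρ2 : ρ ≤ ρ₂ := (min_le_right _ _).trans (min_le_left _ _)
  have hρ1 : ρ ≤ ρ₁ / 4 := (min_le_right _ _).trans (min_le_right _ _)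
  set K := closedBall (0 : ℂ) ρ ∩ {z | ρ / 2 ≤ ‖z‖} with hK
  have hKc : IsCompact K := (isCompact_closedBall 0 ρ).inter_right
    (isClosed_le continuous_const continuous_norm)
  have hKn : K.Nonempty := ⟨(ρ : ℂ), by
    simp [hK, abs_of_pos hρ, hρ.le]⟩
  have hKb : ∀ z ∈ K, z ∈ ball (0 : ℂ) ρ₁ := fun z hz => by
    have := hz.1
    rw [mem_closedBall_zero_iff] at this
    rw [mem_ball_zero_iff]
    linarith
  obtain ⟨x, hx, hmin⟩ := hKc.exists_isMinOn hKn (f := fun z => ‖ψ z‖)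
    (fun z hz => (han z (hKb z hz)).continuousAt.norm.continuousWithinAt)
  have hx0 : 0 < ‖ψ x‖ := by
    refine norm_pos_iff.2 (hball (closedBall_subset_closedBall hρ2 hx.1) ?_)
    have : 0 < ‖x‖ := lt_of_lt_of_le (by positivity) hx.2
    exact norm_pos_iff.1 this
  refine ⟨ρ, hρ, min_le_left _ _, M, hM, M / (‖ψ x‖ / 2), by positivity, ?_⟩
  filter_upwards [hev, Metric.tendstoUniformlyOn_iff.1 hunif (‖ψ x‖ / 2) (by positivity)]
    with n hn hn'
  refine ⟨fun z hz => hn z (closedBall_subset_closedBall (by linarith) hz), fun z hz hz' => ?_⟩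
  have hzK : z ∈ K := ⟨hz, hz'⟩
  have h1 := hn' z (ball_subset_closedBall (hKb z hzK))
  have h2 : ‖ψ x‖ ≤ ‖ψ z‖ := hmin hzK
  rw [dist_eq_norm] at h1
  have h3 := norm_sub_norm_le (ψ z) (F n z)
  rw [div_mul_eq_mul_div, le_div_iff₀ (by positivity)]
  gcongr
  linarith

open Metric in
-- When the limit is infinite at `0`, the reciprocals converge to a limit finite at `0`, because
-- inversion is an isometry. This is why neither constant `0` nor constant `∞` may occur as a limit.
lemma exists_bounds (hF : ∀ n, MeromorphicNFOn (F n) Set.univ)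
    (hfin : ∀ n z, meromorphicOrderAt (F n) z ≠ ⊤)
    (hφ : SphericalTendsto (fun n => toSphere (F n)) φ) (hconst : ¬ ∃ c, ∀ z, φ z = c) :
    ∃ ρ > 0, ρ ≤ 1 ∧ ∃ M > 0, ∃ κ > 0, ∀ᶠ n in atTop, ∃ g, (g = F n ∨ g = (F n)⁻¹) ∧
      (∀ z ∈ closedBall (0 : ℂ) (2 * ρ), AnalyticAt ℂ g z ∧ ‖g z‖ ≤ M) ∧
      ∀ z ∈ closedBall (0 : ℂ) ρ, ρ / 2 ≤ ‖z‖ → M ≤ κ * ‖g z‖ := by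
  by_cases h0 : φ 0 = OnePoint.infty
  · have hF' : ∀ n, MeromorphicNFOn (F n)⁻¹ Set.univ := fun n => meromorphicNFOn_inv.2 (hF n)
    have hφ' : SphericalTendsto (fun n => toSphere (F n)⁻¹) (fun z => sphereInv (φ z)) := by
      intro K hK ε hε
      filter_upwards [hφ K hK ε hε] with n hn z hz
      rw [toSphere_inv (hF n (Set.mem_univ z)) (hfin n z), chordal_sphereInv]
      exact hn z hz
    obtain ⟨ρ, hρ, hρ1, M, hM, κ, hκ, hev⟩ := exists_bounds_of_ne_infty hF' hφ'
      (fun hc => hconst ⟨OnePoint.infty, fun z => by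
        rw [← sphereInv_sphereInv (φ z), hc z, sphereInv_zero]⟩)
      (by rw [h0, sphereInv_infty]; exact OnePoint.coe_ne_infty _)
    exact ⟨ρ, hρ, hρ1, M, hM, κ, hκ, hev.mono fun n hn => ⟨_, Or.inr rfl, hn⟩⟩
  · obtain ⟨ρ, hρ, hρ1, M, hM, κ, hκ, hev⟩ := exists_bounds_of_ne_infty hF hφ
      (fun hc => hconst ⟨_, hc⟩) h0
    exact ⟨ρ, hρ, hρ1, M, hM, κ, hκ, hev.mono fun n hn => ⟨_, Or.inl rfl, hn⟩⟩

end Limit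

end Yosida

/-! ### Rescaling back to `f`: bounds in discs of radius comparable to `|h|^(-β)` -/

namespace Yosida

variable {α β : ℝ} {f : ℂ → ℂ}

lemma norm_cpow_neg_ofReal (h : ℂ) (x : ℝ) : ‖h ^ (-(x : ℂ))‖ = ‖h‖ ^ (-x) := by
  rw [← Complex.ofReal_neg, Complex.norm_cpow_real]

lemma cpow_neg_ne_zero {h : ℂ} (hh : h ≠ 0) (x : ℝ) : h ^ (-(x : ℂ)) ≠ 0 := by
  simp [Complex.cpow_eq_zero_iff, hh]

lemma IsYosida.meromorphicNFAt (hf : IsYosida α β f) (z : ℂ) : MeromorphicNFAt f z :=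
  hf.meromorphic (Set.mem_univ z)

/-- Infinite order at one point spreads over the connected plane, and `f = 0` would be rational. -/
lemma IsYosida.order_ne_top (hf : IsYosida α β f) (z : ℂ) : meromorphicOrderAt f z ≠ ⊤ := by
  intro hz
  refine hf.transcendental ⟨0, 1, one_ne_zero, fun w _ => ?_⟩
  have hw : meromorphicOrderAt f w = ⊤ := by
    by_contra hc
    exact hf.meromorphic.meromorphicOn.meromorphicOrderAt_ne_top_of_isPreconnected
      isPreconnected_univ (Set.mem_univ w) (Set.mem_univ z) hc hz
  have := (hf.meromorphicNFAt w).meromorphicOrderAt_eq_zero_iff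
  by_contra hc
  rw [this.2 (by simpa using hc)] at hw
  exact WithTop.zero_ne_top hw

lemma IsYosida.rescale_meromorphicNFOn (hf : IsYosida α β f) {h : ℂ} (hh : h ≠ 0) :
    MeromorphicNFOn (rescale α β f h) Set.univ := by
  intro z _
  have h1 : MeromorphicNFAt (f ∘ fun z => h + h ^ (-(β : ℂ)) * z) z :=
    (hf.meromorphicNFAt _).comp_analyticAt (by fun_prop)
  exact (meromorphicNFAt_mul_iff_right (g := fun _ => h ^ (-(α : ℂ))) analyticAt_const
    (cpow_neg_ne_zero hh α)).2 h1

lemma IsYosida.rescale_order_ne_top (hf : IsYosida α β f) {h : ℂ} (hh : h ≠ 0) (z : ℂ) :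
    meromorphicOrderAt (rescale α β f h) z ≠ ⊤ := by
  have h1 : AnalyticAt ℂ (fun z => h + h ^ (-(β : ℂ)) * z) z := by fun_prop
  have h2 : deriv (fun z => h + h ^ (-(β : ℂ)) * z) z ≠ 0 := by
    have : HasDerivAt (fun z => h + h ^ (-(β : ℂ)) * z) (h ^ (-(β : ℂ)) * 1) z :=
      ((hasDerivAt_id z).const_mul _).const_add h
    rw [this.deriv, mul_one]
    exact cpow_neg_ne_zero hh β
  have h3 : meromorphicOrderAt (rescale α β f h) z
      = meromorphicOrderAt (f ∘ fun z => h + h ^ (-(β : ℂ)) * z) z :=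
    meromorphicOrderAt_mul_of_ne_zero (g := fun _ => h ^ (-(α : ℂ))) analyticAt_const
      (cpow_neg_ne_zero hh α)
  rw [h3, meromorphicOrderAt_comp_of_deriv_ne_zero h1 h2]
  exact hf.order_ne_top _

open Metric in
-- Compactness: centres at which ever weaker constants fail tend to infinity, and a convergent
-- subsequence of the rescaled functions has a non-constant limit, for which the bounds hold with
-- fixed constants. The factor `h^(-α)` is harmless, since only the ratio of `M` to `|g|` matters.
lemma IsYosida.exists_disc_bounds (hf : IsYosida α β f) :
    ∃ δ > 0, δ ≤ 1 ∧ ∃ κ > 0, ∃ R₀ : ℝ, 1 ≤ R₀ ∧ ∀ h : ℂ, R₀ ≤ ‖h‖ →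
      ∃ ρ, δ * ‖h‖ ^ (-β) ≤ ρ ∧ ρ ≤ ‖h‖ ^ (-β) ∧ ∃ g, (g = f ∨ g = f⁻¹) ∧ ∃ M > 0,
        (∀ z ∈ closedBall h (2 * ρ), AnalyticAt ℂ g z ∧ ‖g z‖ ≤ M) ∧
        ∀ z ∈ closedBall h ρ, ρ / 2 ≤ ‖z - h‖ → M ≤ κ * ‖g z‖ := by
  by_contra! hcon
  have hn : ∀ n : ℕ, (0 : ℝ) < 1 / (n + 1) ∧ (1 : ℝ) / (n + 1) ≤ 1 ∧ (0 : ℝ) < n + 1 ∧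
      (1 : ℝ) ≤ n + 1 := fun n => by
    refine ⟨by positivity, ?_, by positivity, by linarith [(Nat.cast_nonneg n : (0 : ℝ) ≤ n)]⟩
    rw [div_le_one (by positivity)]
    linarith [(Nat.cast_nonneg n : (0 : ℝ) ≤ n)]
  choose h hh hbad using fun n : ℕ => hcon (1 / (n + 1)) (hn n).1 (hn n).2.1 (n + 1) (hn n).2.2.1
    (n + 1) (hn n).2.2.2
  obtain ⟨k, hk, φ, hφ⟩ := hf.normal h fun n => (hn n).2.2.2.trans (hh n)
  have hkn : ∀ n : ℕ, (n : ℝ) ≤ ‖h (k n)‖ := fun n => by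
    have h1 : (n : ℝ) ≤ k n := by exact_mod_cast hk.id_le n
    linarith [hh (k n)]
  have hne : ∀ n, h n ≠ 0 := fun n => by
    have := (hn n).2.2.1.trans_le (hh n)
    exact norm_pos_iff.1 this
  have hconst := hf.limit_nonconstant (fun n => h (k n)) φ
    (tendsto_atTop_mono hkn tendsto_natCast_atTop_atTop) hφ
  obtain ⟨ρ, hρ, hρ1, M, hM, κ, hκ, hev⟩ := exists_bounds
    (fun n => hf.rescale_meromorphicNFOn (hne (k n)))
    (fun n z => hf.rescale_order_ne_top (hne (k n)) z) hφ hconst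
  -- `ρ` and `κ` are fixed, whereas the constants refuted at index `k n` are `1/(k n + 1)` and `k n
  -- + 1`. For large `n` this is a contradiction.
  obtain ⟨n, ⟨g, hg, hg1, hg2⟩, hn1⟩ := (hev.and
    (eventually_ge_atTop (⌈max (1 / ρ) κ⌉₊))).exists
  have hnk : max (1 / ρ) κ ≤ (k n : ℝ) + 1 := by
    have h1 : max (1 / ρ) κ ≤ (n : ℝ) := (Nat.le_ceil _).trans (by exact_mod_cast hn1)
    have h2 : (n : ℝ) ≤ k n := by exact_mod_cast hk.id_le n
    linarith
  set H := h (k n) with hH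
  have hH0 : H ≠ 0 := hne (k n)
  set c := H ^ (-(α : ℂ)) with hc
  set d := H ^ (-(β : ℂ)) with hd
  have hc0 : c ≠ 0 := cpow_neg_ne_zero hH0 α
  have hd0 : d ≠ 0 := cpow_neg_ne_zero hH0 β
  have hdn : ‖d‖ = ‖H‖ ^ (-β) := norm_cpow_neg_ofReal H β
  have hdp : 0 < ‖d‖ := norm_pos_iff.2 hd0
  have hscale : ∀ w, rescale α β f H ((w - H) / d) = c * f w := by
    intro w
    rw [rescale, ← hc, ← hd, mul_div_cancel₀ _ hd0, add_sub_cancel]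
  -- The rescaled function (or its reciprocal) is pulled back to `f` (or `1/f`); `e` undoes the
  -- factor `c` and is absorbed in the bound `‖e‖ * M`.
  obtain ⟨G, e, he0, hG, hGe⟩ : ∃ G e, e ≠ 0 ∧ (G = f ∨ G = f⁻¹) ∧
      G = fun w => e * g ((w - H) / d) := by
    rcases hg with rfl | rfl
    · refine ⟨f, c⁻¹, inv_ne_zero hc0, Or.inl rfl, ?_⟩
      ext w
      rw [hscale, inv_mul_cancel_left₀ hc0]
    · refine ⟨f⁻¹, c, hc0, Or.inr rfl, ?_⟩
      ext w
      rw [Pi.inv_apply, Pi.inv_apply, hscale, mul_inv, mul_inv_cancel_left₀ hc0]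
  have hnorm : ∀ w, ‖(w - H) / d‖ = ‖w - H‖ / ‖d‖ := fun w => norm_div _ _
  obtain ⟨z, hz, hz1, hz2⟩ := hbad (k n) (ρ * ‖d‖)
    (by
      rw [← hH, ← hdn]
      refine mul_le_mul_of_nonneg_right ?_ hdp.le
      rw [one_div_le (by positivity) hρ]
      exact (le_max_left _ _).trans hnk)
    (by rw [← hH, ← hdn]; nlinarith) G hG (‖e‖ * M) (mul_pos (norm_pos_iff.2 he0) hM)
    (fun z hz => by
      rw [mem_closedBall_iff_norm, ← mul_assoc, ← div_le_iff₀ hdp, ← hnorm,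
        ← mem_closedBall_zero_iff] at hz
      obtain ⟨h1, h2⟩ := hg1 _ hz
      refine ⟨?_, ?_⟩
      · rw [hGe]
        have h3 : AnalyticAt ℂ (fun w => (w - H) / d) z :=
          (analyticAt_id.sub analyticAt_const).div analyticAt_const hd0
        exact analyticAt_const.mul (AnalyticAt.fun_comp (f := fun w => (w - H) / d) h1 h3)
      · rw [hGe, norm_mul]
        gcongr)
  rw [mem_closedBall_iff_norm, ← div_le_iff₀ hdp, ← hH, ← hnorm, ← mem_closedBall_zero_iff] at hz
  have h1 := hg2 _ hz (by rw [hnorm, le_div_iff₀ hdp]; linarith)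
  have h2 : ‖e‖ * M ≤ ((k n : ℝ) + 1) * ‖G z‖ := by
    rw [hGe, norm_mul]
    calc ‖e‖ * M ≤ ‖e‖ * (κ * ‖g ((z - H) / d)‖) := by gcongr
      _ ≤ ‖e‖ * (((k n : ℝ) + 1) * ‖g ((z - H) / d)‖) := by
        gcongr
        exact (le_max_right _ _).trans hnk
      _ = _ := by ring
  linarith

lemma logDeriv_inv_eq (hf : ∀ z, MeromorphicNFAt f z) (z : ℂ) :
    logDeriv f⁻¹ z = -logDeriv f z := by
  -- At zeros, and at poles where the normal form is `0`, both sides have the default value `0`.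
  by_cases h : f z = 0
  · simp [logDeriv_apply, h]
  · have ha : AnalyticAt ℂ f z := (hf z).meromorphicOrderAt_nonneg_iff_analyticAt.1
      ((hf z).meromorphicOrderAt_eq_zero_iff.2 h).ge
    have := (ha.differentiableAt.hasDerivAt.inv h).deriv
    rw [logDeriv_apply, logDeriv_apply, this, Pi.inv_apply]
    field_simp

open Metric MeasureTheory in
/-- Local density bounds for the zeros and poles and for the logarithmic derivative. -/
theorem IsYosida.exists_local_bounds (hf : IsYosida α β f) :
    ∃ δ > 0, δ ≤ 1 ∧ ∃ C > 0, ∃ R₀ : ℝ, 1 ≤ R₀ ∧ ∀ h : ℂ, R₀ ≤ ‖h‖ →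
      (∀ Z : Finset ℂ, (∀ a ∈ Z, a ∈ closedBall h (δ * ‖h‖ ^ (-β))) →
        ∑ a ∈ Z, |(mult f a : ℝ)| ≤ C) ∧
      ∫⁻ z in closedBall h (δ * ‖h‖ ^ (-β)), ‖logDeriv f z‖ₑ
        ≤ ENNReal.ofReal (C * ‖h‖ ^ (-β)) := by
  obtain ⟨δ, hδ, hδ1, κ, hκ, R₀, hR₀, H⟩ := hf.exists_disc_bounds
  -- The area bound of `disc_bounds` holds only on the disc of half the radius, hence `δ / 2`.
  refine ⟨δ / 2, by positivity, by linarith, 10 * κ, by positivity, R₀, hR₀, fun h hh => ?_⟩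
  obtain ⟨ρ, hρ1, hρ2, g, hg, M, hM, hg1, hg2⟩ := H h hh
  have hp : 0 < ‖h‖ ^ (-β) := Real.rpow_pos_of_pos (by linarith) _
  have hρ : 0 < ρ := lt_of_lt_of_le (by positivity) hρ1
  have hgN : MeromorphicNFOn g Set.univ := by
    rcases hg with rfl | rfl
    · exact hf.meromorphic
    · exact meromorphicNFOn_inv.2 hf.meromorphic
  have hgt : ∀ z, meromorphicOrderAt g z ≠ ⊤ := by
    intro z
    rcases hg with rfl | rfl
    · exact hf.order_ne_top z
    · rw [meromorphicOrderAt_inv, coe_mult (hf.order_ne_top z)]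
      exact WithTop.coe_ne_top
  have hm : ∀ a, |(mult g a : ℝ)| = |(mult f a : ℝ)| := by
    intro a
    rcases hg with rfl | rfl
    · rfl
    · rw [mult_inv]; push_cast; rw [abs_neg]
  have hl : ∀ z, ‖logDeriv g z‖ₑ = ‖logDeriv f z‖ₑ := by
    intro z
    rcases hg with rfl | rfl
    · rfl
    · rw [logDeriv_inv_eq hf.meromorphicNFAt, enorm_neg]
  obtain ⟨h1, h2⟩ := disc_bounds hgN hgt hρ hM (fun z hz => (hg1 z hz).1) (fun z hz => (hg1 z hz).2)
    hg2
  simp only [hm, hl] at h1 h2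
  have hsub : closedBall h (δ / 2 * ‖h‖ ^ (-β)) ⊆ closedBall h (ρ / 2) :=
    closedBall_subset_closedBall (by linarith)
  refine ⟨fun Z hZ => (h1 Z fun a ha => ?_).trans (by linarith), ?_⟩
  · exact closedBall_subset_closedBall (by linarith) (hsub (hZ a ha))
  · refine (lintegral_mono_set hsub).trans (h2.trans (ENNReal.ofReal_le_ofReal ?_))
    gcongr

end Yosida

/-! ### Thin annuli and good circles -/

namespace Yosida

/-- Equidistributed points on the circle of radius `R` about the origin. -/
noncomputable def circlePoint (R : ℝ) (N : ℕ) (j : ℕ) : ℂ :=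
  R * Complex.exp (Complex.I * ((2 * Real.pi * j / N - Real.pi : ℝ) : ℂ))

lemma norm_circlePoint {R : ℝ} (hR : 0 ≤ R) (N j : ℕ) : ‖circlePoint R N j‖ = R := by
  rw [circlePoint, norm_mul, Complex.norm_exp_I_mul_ofReal, mul_one, Complex.norm_real,
    Real.norm_of_nonneg hR]

lemma norm_exp_sub_exp_le (x y : ℝ) :
    ‖Complex.exp (Complex.I * x) - Complex.exp (Complex.I * y)‖ ≤ |x - y| := by
  have : Complex.exp (Complex.I * x) - Complex.exp (Complex.I * y)
      = Complex.exp (Complex.I * y) * (Complex.exp (Complex.I * ((x - y : ℝ) : ℂ)) - 1) := by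
    rw [mul_sub, ← Complex.exp_add, mul_one]
    push_cast
    ring_nf
  rw [this, norm_mul, Complex.norm_exp_I_mul_ofReal, one_mul]
  exact Real.norm_exp_I_mul_ofReal_sub_one_le

/-- A thin annulus is covered by discs centred at equidistributed points. -/
lemma exists_mem_closedBall_circlePoint {R d : ℝ} (hR : 0 < R) (hd : 0 < d) {N : ℕ}
    (hN : 2 * Real.pi * R / d ≤ N) {z : ℂ} (h1 : R ≤ ‖z‖) (h2 : ‖z‖ ≤ R + d) :
    ∃ j : Fin (N + 1), z ∈ Metric.closedBall (circlePoint R N j) (2 * d) := by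
  have hπ := Real.pi_pos
  have hN0 : (0 : ℝ) < N := lt_of_lt_of_le (by positivity) hN
  set θ := z.arg + Real.pi with hθ
  have hθ0 : 0 ≤ θ := by linarith [Complex.neg_pi_lt_arg z]
  have hθ1 : θ ≤ 2 * Real.pi := by linarith [Complex.arg_le_pi z]
  set x := θ * N / (2 * Real.pi) with hx
  have hx0 : 0 ≤ x := by positivity
  set j := ⌊x⌋₊ with hj
  have hjx : (j : ℝ) ≤ x := Nat.floor_le hx0
  have hxj : x < j + 1 := Nat.lt_floor_add_one x
  -- The value `j = N` occurs for argument `π`, which is why `N + 1` centres are used.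
  have hjN : j ≤ N := by
    rw [hj]
    refine Nat.floor_le_of_le ?_
    rw [hx, div_le_iff₀ (by positivity), mul_comm (N : ℝ)]
    gcongr
  refine ⟨⟨j, by omega⟩, ?_⟩
  rw [mem_closedBall_iff_norm]
  -- The angular error is at most `2π/N ≤ d/R`, an arc of length at most `d`. Together with the
  -- radial error, also at most `d`, this gives the radius `2 * d`.
  have hang : |z.arg - (2 * Real.pi * j / N - Real.pi)| ≤ d / R := by
    have e : z.arg - (2 * Real.pi * j / N - Real.pi) = 2 * Real.pi / N * (x - j) := by
      rw [hx, hθ]; field_simp; ring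
    rw [e, abs_of_nonneg (mul_nonneg (by positivity) (by linarith))]
    calc 2 * Real.pi / N * (x - j) ≤ 2 * Real.pi / N * 1 := by gcongr; linarith
      _ ≤ d / R := by
        rw [mul_one, div_le_div_iff₀ hN0 hR]
        rw [div_le_iff₀ hd] at hN
        linarith
  have hz : z = ‖z‖ * Complex.exp (Complex.I * z.arg) := by
    rw [mul_comm Complex.I]; exact (Complex.norm_mul_exp_arg_mul_I z).symm
  have e2 : z - circlePoint R N j = ((‖z‖ - R : ℝ) : ℂ) * Complex.exp (Complex.I * z.arg)
      + R * (Complex.exp (Complex.I * z.arg)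
        - Complex.exp (Complex.I * ((2 * Real.pi * j / N - Real.pi : ℝ) : ℂ))) := by
    conv_lhs => rw [hz]
    rw [circlePoint]
    push_cast
    ring
  show ‖z - circlePoint R N j‖ ≤ _
  rw [e2]
  refine (norm_add_le _ _).trans ?_
  rw [norm_mul, norm_mul, Complex.norm_exp_I_mul_ofReal, Complex.norm_real, Complex.norm_real,
    Real.norm_of_nonneg hR.le, Real.norm_of_nonneg (by linarith), mul_one]
  have := (norm_exp_sub_exp_le _ _).trans hang
  have h5 : R * ‖Complex.exp (Complex.I * z.arg)
        - Complex.exp (Complex.I * ((2 * Real.pi * j / N - Real.pi : ℝ) : ℂ))‖ ≤ R * (d / R) := by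
    gcongr
  have h6 : R * (d / R) = d := by field_simp
  linarith

open MeasureTheory in
lemma lintegral_polar_le {F : ℂ → ENNReal} (hF : Measurable F) {A : Set ℂ} (hA : MeasurableSet A)
    {R d : ℝ} (hR : 0 < R) (hsub : ∀ z : ℂ, R ≤ ‖z‖ → ‖z‖ ≤ R + d → z ∈ A) :
    ∫⁻ r in Set.Icc R (R + d), ∫⁻ θ in Set.Ioo (-Real.pi) Real.pi,
      ENNReal.ofReal r * F (circleMap 0 r θ) ≤ ∫⁻ z in A, F z := by
  have hmeas : Measurable fun p : ℝ × ℝ => ENNReal.ofReal p.1 * F (circleMap 0 p.1 p.2) := by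
    refine (ENNReal.measurable_ofReal.comp measurable_fst).mul (hF.comp ?_)
    unfold circleMap
    fun_prop
  rw [← lintegral_prod (μ := volume.restrict (Set.Icc R (R + d)))
    (ν := volume.restrict (Set.Ioo (-Real.pi) Real.pi))
    (fun p : ℝ × ℝ => ENNReal.ofReal p.1 * F (circleMap 0 p.1 p.2)) hmeas.aemeasurable,
    Measure.prod_restrict, ← lintegral_indicator hA, ← Complex.lintegral_comp_polarCoord_symm,
    ← Measure.volume_eq_prod]
  refine le_trans ?_ (lintegral_mono_set (s := Set.Icc R (R + d) ×ˢ Set.Ioo (-Real.pi) Real.pi) ?_)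
  · refine setLIntegral_mono' (measurableSet_Icc.prod measurableSet_Ioo) fun p hp => ?_
    have hp0 : 0 < p.1 := hR.trans_le hp.1.1
    have e : Complex.polarCoord.symm p = circleMap 0 p.1 p.2 := by
      rw [Complex.polarCoord_symm_apply, circleMap, zero_add, Complex.exp_mul_I,
        Complex.ofReal_cos, Complex.ofReal_sin]
    have hn : ‖circleMap 0 p.1 p.2‖ = p.1 := by rw [norm_circleMap_zero, abs_of_pos hp0]
    rw [e, Set.indicator_of_mem (hsub _ (by rw [hn]; exact hp.1.1) (by rw [hn]; exact hp.1.2)),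
      smul_eq_mul]
  · rw [polarCoord_target]
    exact Set.prod_mono (fun x hx => hR.trans_le hx.1) subset_rfl

open MeasureTheory in
-- Bounds the kernel pointwise and the other factor only in the mean. By periodicity the angle runs
-- over `(-π, π)`, the range of polar coordinates.
lemma norm_circleIntegral_le {F k : ℂ → ℂ} {r B c : ℝ} (hr : 0 ≤ r) (hB : 0 ≤ B) (hc : 0 ≤ c)
    (hk : ∀ z ∈ Metric.sphere (0 : ℂ) r, ‖k z‖ ≤ B)
    (hF : ∫⁻ θ in Set.Ioo (-Real.pi) Real.pi, ENNReal.ofReal r * ‖F (circleMap 0 r θ)‖ₑ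
      ≤ ENNReal.ofReal c) :
    ‖∮ z in C(0, r), F z * k z‖ ≤ B * c := by
  have hper : Function.Periodic (fun θ => deriv (circleMap 0 r) θ •
      (F (circleMap 0 r θ) * k (circleMap 0 r θ))) (2 * Real.pi) := by
    intro θ
    simp only [deriv_circleMap, periodic_circleMap (0 : ℂ) r θ]
  have h1 := hper.intervalIntegral_add_eq 0 (-Real.pi)
  rw [zero_add] at h1
  have h2 : -Real.pi + 2 * Real.pi = Real.pi := by ring
  rw [circleIntegral, h1, h2, intervalIntegral.integral_of_le (by linarith [Real.pi_pos]),
    integral_Ioc_eq_integral_Ioo]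
  refine (norm_integral_le_lintegral_norm _).trans ?_
  refine ENNReal.toReal_le_of_le_ofReal (by positivity) ?_
  rw [ENNReal.ofReal_mul hB]
  refine le_trans ?_ (mul_le_mul_right hF _)
  rw [← lintegral_const_mul' _ _ ENNReal.ofReal_ne_top]
  refine lintegral_mono fun θ => ?_
  have hs : circleMap 0 r θ ∈ Metric.sphere (0 : ℂ) r := circleMap_mem_sphere 0 hr θ
  rw [← ofReal_norm, ← ENNReal.ofReal_mul hr, ← ENNReal.ofReal_mul hB]
  refine ENNReal.ofReal_le_ofReal ?_
  rw [norm_smul, deriv_circleMap, norm_mul, norm_mul, norm_circleMap_zero, abs_of_nonneg hr,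
    Complex.norm_I, mul_one]
  calc r * (‖F (circleMap 0 r θ)‖ * ‖k (circleMap 0 r θ)‖)
      ≤ r * (‖F (circleMap 0 r θ)‖ * B) := by gcongr; exact hk _ hs
    _ = _ := by ring

variable {α β : ℝ} {f : ℂ → ℂ}

open MeasureTheory Metric in
/-- Density of zeros and poles in thin annuli, and existence of circles on which the logarithmic
derivative is small in the mean. -/
theorem IsYosida.exists_annulus_bounds (hβ : -1 < β) (hf : IsYosida α β f) :
    ∃ δ > 0, δ ≤ 1 ∧ ∃ C > 0, ∃ R₀ : ℝ, 1 ≤ R₀ ∧ ∀ R : ℝ, R₀ ≤ R →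
      (∀ Z : Finset ℂ, (∀ a ∈ Z, R ≤ ‖a‖ ∧ ‖a‖ ≤ R + δ * R ^ (-β)) →
        ∑ a ∈ Z, |(mult f a : ℝ)| ≤ C * R ^ (1 + β)) ∧
      ∃ r, R ≤ r ∧ r ≤ R + δ * R ^ (-β) ∧ (∀ a, ‖a‖ = r → mult f a = 0) ∧
        ∀ (k : ℂ → ℂ) (B : ℝ), 0 ≤ B → (∀ z ∈ sphere (0 : ℂ) r, ‖k z‖ ≤ B) →
          ‖∮ z in C(0, r), logDeriv f z * k z‖ ≤ B * (C * r ^ (1 + β)) := by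
  classical
  obtain ⟨δ, hδ, hδ1, C, hC, R₀, hR₀, H⟩ := hf.exists_local_bounds
  have hπ := Real.pi_pos
  -- Bounds the number of covering discs: `N + 1 ≤ (4π/δ) R^(1+β) + 2`, and `R^(1+β) ≥ 1`.
  set C₁ := 4 * Real.pi / δ + 2 with hC₁
  have hC₁0 : 0 < C₁ := by positivity
  refine ⟨δ / 2, by positivity, by linarith, max (C₁ * C) (C₁ * C * 2 / δ), by positivity, R₀, hR₀,
    fun R hR => ?_⟩
  have hR1 : 1 ≤ R := hR₀.trans hR
  have hR0 : 0 < R := by linarith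
  set d := δ / 2 * R ^ (-β) with hd
  have hRβ : 0 < R ^ (-β) := Real.rpow_pos_of_pos hR0 _
  have hd0 : 0 < d := by positivity
  have hmulpow : R ^ (1 + β) * R ^ (-β) = R := by
    rw [← Real.rpow_add hR0]; simp
  have hRp : 0 < R ^ (1 + β) := Real.rpow_pos_of_pos hR0 _
  have hRp1 : 1 ≤ R ^ (1 + β) := Real.one_le_rpow hR1 (by linarith)
  set N := ⌈2 * Real.pi * R / d⌉₊ with hN
  have hNle : 2 * Real.pi * R / d ≤ N := Nat.le_ceil _
  have hN1 : ((N + 1 : ℕ) : ℝ) ≤ C₁ * R ^ (1 + β) := by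
    have h1 : (N : ℝ) < 2 * Real.pi * R / d + 1 := Nat.ceil_lt_add_one (by positivity)
    have h2 : 2 * Real.pi * R / d = 4 * Real.pi / δ * R ^ (1 + β) := by
      rw [hd]
      nth_rewrite 1 [← hmulpow]
      field_simp
      ring
    rw [hC₁]
    push_cast
    linarith
  have hcov : ∀ z : ℂ, R ≤ ‖z‖ → ‖z‖ ≤ R + d →
      z ∈ ⋃ j : Fin (N + 1), closedBall (circlePoint R N j) (δ * R ^ (-β)) := by
    intro z h1 h2
    obtain ⟨j, hj⟩ := exists_mem_closedBall_circlePoint hR0 hd0 hNle h1 h2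
    rw [show 2 * d = δ * R ^ (-β) by rw [hd]; ring] at hj
    exact Set.mem_iUnion.2 ⟨j, hj⟩
  have hcp : ∀ j : Fin (N + 1), ‖circlePoint R N j‖ = R := fun j => norm_circlePoint hR0.le N j
  have hH : ∀ j : Fin (N + 1), _ := fun j => H (circlePoint R N j) (by rw [hcp]; exact hR)
  simp only [hcp] at hH
  refine ⟨fun Z hZ => ?_, ?_⟩
  · calc ∑ a ∈ Z, |(mult f a : ℝ)|
        ≤ ∑ a ∈ Z, ∑ j : Fin (N + 1), if a ∈ closedBall (circlePoint R N j) (δ * R ^ (-β))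
            then |(mult f a : ℝ)| else 0 := by
          refine Finset.sum_le_sum fun a ha => ?_
          obtain ⟨j, hj⟩ := Set.mem_iUnion.1 (hcov a (hZ a ha).1 (hZ a ha).2)
          refine le_trans ?_ (Finset.single_le_sum (fun i _ => ?_) (Finset.mem_univ j))
          · rw [if_pos hj]
          · split_ifs <;> positivity
      _ = ∑ j : Fin (N + 1), ∑ a ∈ Z with a ∈ closedBall (circlePoint R N j) (δ * R ^ (-β)),
            |(mult f a : ℝ)| := by
          rw [Finset.sum_comm]
          simp only [Finset.sum_filter]
      _ ≤ ∑ _j : Fin (N + 1), C :=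
          Finset.sum_le_sum fun j _ => (hH j).1 _ fun a ha => (Finset.mem_filter.1 ha).2
      _ = ((N + 1 : ℕ) : ℝ) * C := by simp
      _ ≤ C₁ * R ^ (1 + β) * C := by gcongr
      _ = C₁ * C * R ^ (1 + β) := by ring
      _ ≤ _ := by gcongr; exact le_max_left _ _
  · have hfm : Measurable f := Meromorphic.measurable fun z => (hf.meromorphicNFAt z).meromorphicAt
    have hFm : Measurable fun z => ‖logDeriv f z‖ₑ := by
      have : Measurable (logDeriv f) := (measurable_deriv f).div hfm
      exact this.enorm
    have hA : MeasurableSet (⋃ j : Fin (N + 1), closedBall (circlePoint R N j) (δ * R ^ (-β))) :=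
      MeasurableSet.iUnion fun j => isClosed_closedBall.measurableSet
    have hpol := lintegral_polar_le hFm hA hR0 hcov
    -- `O(R^(1+β))` discs, each contributing `O(R^(-β))`, give an area integral `O(R)`.
    have hupp : ∫⁻ z in ⋃ j : Fin (N + 1), closedBall (circlePoint R N j) (δ * R ^ (-β)),
        ‖logDeriv f z‖ₑ ≤ ENNReal.ofReal (C₁ * C * R) := by
      refine (lintegral_iUnion_le _ _).trans ?_
      rw [tsum_fintype]
      refine (Finset.sum_le_sum fun j _ => (hH j).2).trans ?_
      rw [Finset.sum_const, Finset.card_univ, Fintype.card_fin, nsmul_eq_mul,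
        ← ENNReal.ofReal_natCast, ← ENNReal.ofReal_mul (by positivity)]
      refine ENNReal.ofReal_le_ofReal ?_
      calc ((N + 1 : ℕ) : ℝ) * (C * R ^ (-β)) ≤ C₁ * R ^ (1 + β) * (C * R ^ (-β)) := by gcongr
        _ = C₁ * C * (R ^ (1 + β) * R ^ (-β)) := by ring
        _ = _ := by rw [hmulpow]
    set Φ : ℝ → ENNReal := fun r => ∫⁻ θ in Set.Ioo (-Real.pi) Real.pi,
      ENNReal.ofReal r * ‖logDeriv f (circleMap 0 r θ)‖ₑ with hΦ
    have hΦm : Measurable Φ := by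
      refine Measurable.lintegral_prod_right' (f := fun p : ℝ × ℝ =>
        ENNReal.ofReal p.1 * ‖logDeriv f (circleMap 0 p.1 p.2)‖ₑ) ?_
      refine (ENNReal.measurable_ofReal.comp measurable_fst).mul (hFm.comp ?_)
      unfold circleMap
      fun_prop
    set μ := (volume : Measure ℝ).restrict (Set.Icc R (R + d)) with hμ
    have hμu : μ Set.univ = ENNReal.ofReal d := by
      rw [hμ, Measure.restrict_apply_univ, Real.volume_Icc]; congr 1; ring
    have hμ0 : μ ≠ 0 := by
      intro h0
      rw [h0] at hμu
      simp at hμu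
      linarith
    -- Null set of forbidden radii: those outside the annulus, and the finitely many moduli of zeros
    -- and poles.
    set S : Set ℝ := (Set.Icc R (R + d))ᶜ ∪
      norm '' {a | a ∈ closedBall (0 : ℂ) (R + d) ∧ mult f a ≠ 0} with hS
    have hSμ : μ S = 0 := by
      refine measure_union_null ?_ ?_
      · rw [hμ, Measure.restrict_apply measurableSet_Icc.compl]; simp
      · exact ((finite_mult_ne_zero hf.meromorphic 0 (R + d)).image _).measure_zero _
    have : IsFiniteMeasure μ := by rw [hμ]; infer_instance
    obtain ⟨r, hrS, hr⟩ := exists_notMem_null_le_laverage hμ0 hΦm.aemeasurable hSμ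
    rw [hS, Set.mem_union, not_or, Set.mem_compl_iff, not_not] at hrS
    obtain ⟨⟨hr1, hr2⟩, hr3⟩ := hrS
    have hr0 : 0 < r := by linarith
    refine ⟨r, hr1, hr2, fun a ha => ?_, fun k B hB hk => ?_⟩
    · by_contra hne
      exact hr3 ⟨a, ⟨by rw [mem_closedBall_zero_iff, ha]; exact hr2, hne⟩, ha⟩
    · have hΦr : Φ r ≤ ENNReal.ofReal (C₁ * C * 2 / δ * R ^ (1 + β)) := by
        refine hr.trans ?_
        rw [laverage_eq, hμu]
        refine (ENNReal.div_le_div_right (hpol.trans hupp) _).trans ?_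
        rw [← ENNReal.ofReal_div_of_pos hd0]
        refine ENNReal.ofReal_le_ofReal (le_of_eq ?_)
        rw [hd]
        nth_rewrite 1 [← hmulpow]
        field_simp
      refine norm_circleIntegral_le hr0.le hB (by positivity) hk (hΦr.trans ?_)
      refine ENNReal.ofReal_le_ofReal ?_
      have : R ^ (1 + β) ≤ r ^ (1 + β) := Real.rpow_le_rpow hR0.le hr1 (by linarith)
      gcongr
      exact le_max_right _ _

end Yosida

/-! ### Prime factors and finite canonical products -/

namespace Yosida

section PrimeFactor

lemma primeFactor_zero (m : ℕ) : primeFactor m 0 = 1 := by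
  rw [primeFactor, Finset.sum_eq_zero, Complex.exp_zero]
  · simp
  · intro j hj
    have : j ≠ 0 := by have := (Finset.mem_Icc.1 hj).1; omega
    simp [this]

lemma primeFactor_genus_zero : primeFactor 0 = fun u => 1 - u := by
  ext u
  simp [primeFactor]

lemma analyticAt_primeFactor (m : ℕ) (u : ℂ) : AnalyticAt ℂ (primeFactor m) u := by
  have : AnalyticAt ℂ (fun u : ℂ => (1 - u) *
      Complex.exp (∑ j ∈ Finset.Icc 1 m, u ^ j / (j : ℂ))) u := by
    refine (analyticAt_const.sub analyticAt_id).mul (AnalyticAt.cexp ?_)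
    exact Finset.analyticAt_fun_sum _ fun j _ => (analyticAt_id.pow j).div_const
  exact this

/-- The elementary factor vanishing exactly at `a`. -/
noncomputable def factor (m : ℕ) (a z : ℂ) : ℂ := if a = 0 then z else primeFactor m (z / a)

lemma factor_zero (m : ℕ) : factor m 0 = id := by ext z; simp [factor]

lemma factor_of_ne {a : ℂ} (ha : a ≠ 0) (m : ℕ) : factor m a = fun z => primeFactor m (z / a) := by
  ext z; simp [factor, ha]

lemma analyticAt_factor (m : ℕ) (a z : ℂ) : AnalyticAt ℂ (factor m a) z := by
  by_cases ha : a = 0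
  · rw [ha, factor_zero]; exact analyticAt_id
  · rw [factor_of_ne ha]
    exact AnalyticAt.fun_comp (f := fun z => z / a) (analyticAt_primeFactor m _)
      (analyticAt_id.div_const)

/-- Both kinds of factor are a zero-free entire function times `z - a`, so order and non-vanishing
need no case distinction later. -/
lemma factor_eq (m : ℕ) (a : ℂ) : ∃ u : ℂ → ℂ, (∀ z, AnalyticAt ℂ u z ∧ u z ≠ 0) ∧
    factor m a = fun z => u z * (z - a) := by
  by_cases ha : a = 0
  · refine ⟨fun _ => 1, fun z => ⟨analyticAt_const, one_ne_zero⟩, ?_⟩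
    rw [ha, factor_zero]; ext z; simp
  · refine ⟨fun z => -a⁻¹ * Complex.exp (∑ j ∈ Finset.Icc 1 m, (z / a) ^ j / (j : ℂ)),
      fun z => ⟨?_, mul_ne_zero (neg_ne_zero.2 (inv_ne_zero ha)) (Complex.exp_ne_zero _)⟩, ?_⟩
    · refine analyticAt_const.mul (AnalyticAt.cexp ?_)
      exact Finset.analyticAt_fun_sum _ fun j _ => ((analyticAt_id.div_const).pow j).div_const
    · rw [factor_of_ne ha]; ext z
      rw [primeFactor]
      field_simp
      ring

lemma order_factor (m : ℕ) (a z : ℂ) :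
    meromorphicOrderAt (factor m a) z = if z = a then 1 else 0 := by
  obtain ⟨u, hu, h⟩ := factor_eq m a
  have h1 : meromorphicOrderAt (factor m a) z = meromorphicOrderAt (fun z => z - a) z := by
    rw [h]
    exact meromorphicOrderAt_mul_of_ne_zero (hu z).1 (hu z).2
  rw [h1]
  split_ifs with hza
  · subst hza; exact meromorphicOrderAt_id_sub_const
  · have : AnalyticAt ℂ (fun z => z - a) z := by fun_prop
    exact (this.meromorphicNFAt.meromorphicOrderAt_eq_zero_iff).2 (sub_ne_zero.2 hza)

lemma factor_ne_zero (m : ℕ) {a z : ℂ} (h : z ≠ a) : factor m a z ≠ 0 := by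
  obtain ⟨u, hu, h'⟩ := factor_eq m a
  rw [h']
  exact mul_ne_zero (hu z).2 (sub_ne_zero.2 h)

lemma logDeriv_factor_zero (m : ℕ) (z : ℂ) : logDeriv (factor m 0) z = 1 / z := by
  rw [factor_zero, logDeriv_id]

/-- The exponent contributes a geometric sum equal to `((z/a)^m - 1)/(z - a)`, whose second term
cancels the logarithmic derivative of `1 - z/a`. -/
lemma logDeriv_primeFactor (m : ℕ) {a z : ℂ} (ha : a ≠ 0) (hz : z ≠ a) :
    logDeriv (factor m a) z = z ^ m / (a ^ m * (z - a)) := by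
  have hza : z - a ≠ 0 := sub_ne_zero.2 hz
  have hu : z / a ≠ 1 := by rwa [Ne, div_eq_one_iff_eq ha]
  have h1 : HasDerivAt (fun z : ℂ => ∑ j ∈ Finset.Icc 1 m, (z / a) ^ j / (j : ℂ))
      (∑ j ∈ Finset.Icc 1 m, (z / a) ^ (j - 1) / a) z := by
    refine HasDerivAt.fun_sum fun j hj => ?_
    have hj0 : (j : ℂ) ≠ 0 := by
      have := (Finset.mem_Icc.1 hj).1
      exact_mod_cast (by omega : j ≠ 0)
    have h := (((hasDerivAt_id' z).div_const a).fun_pow j).div_const (j : ℂ)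
    refine h.congr_deriv ?_
    field_simp
  have h2 : ∑ j ∈ Finset.Icc 1 m, (z / a) ^ (j - 1) / a = ((z / a) ^ m - 1) / (z - a) := by
    have hI : Finset.Icc 1 m = Finset.Ico 1 (m + 1) := by ext; simp
    rw [← Finset.sum_div, hI, Finset.sum_Ico_eq_sum_range]
    simp only [Nat.add_sub_cancel_left, Nat.add_sub_cancel]
    rw [geom_sum_eq hu]
    field_simp
  have h3 : HasDerivAt (fun z : ℂ => 1 - z / a) (-(1 / a)) z :=
    ((hasDerivAt_id z).div_const a).const_sub 1
  have h4 := h3.mul h1.cexp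
  have hexp := Complex.exp_ne_zero (∑ j ∈ Finset.Icc 1 m, (z / a) ^ j / (j : ℂ))
  have h1z : 1 - z / a ≠ 0 := sub_ne_zero.2 (Ne.symm hu)
  have h5 : factor m a = (fun z : ℂ => 1 - z / a) *
      fun z => Complex.exp (∑ j ∈ Finset.Icc 1 m, (z / a) ^ j / (j : ℂ)) := by
    rw [factor_of_ne ha]; rfl
  rw [logDeriv_apply, h5, h4.deriv, h2, Pi.mul_apply, div_pow]
  have : a - z ≠ 0 := sub_ne_zero.2 (Ne.symm hz)
  field_simp
  ring

end PrimeFactor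

section Products

variable {f : ℂ → ℂ}

lemma finite_zeroPole (hf : MeromorphicNFOn f Set.univ) (r : ℝ) :
    {a : ℂ | a ≠ 0 ∧ ‖a‖ < r ∧ mult f a ≠ 0}.Finite :=
  (finite_mult_ne_zero hf 0 r).subset fun _ ha =>
    ⟨by simpa using ha.2.1.le, ha.2.2⟩

open Classical in
/-- The non-zero zeros and poles of `f` of modulus less than `r`. -/
noncomputable def zeroPole (f : ℂ → ℂ) (r : ℝ) : Finset ℂ :=
  if h : {a : ℂ | a ≠ 0 ∧ ‖a‖ < r ∧ mult f a ≠ 0}.Finite then h.toFinset else ∅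

lemma mem_zeroPole (hf : MeromorphicNFOn f Set.univ) {r : ℝ} {a : ℂ} :
    a ∈ zeroPole f r ↔ a ≠ 0 ∧ ‖a‖ < r ∧ mult f a ≠ 0 := by
  simp [zeroPole, finite_zeroPole hf r]

lemma zeroMult_eq (f : ℂ → ℂ) (a : ℂ) : zeroMult f a = (mult f a).toNat := rfl

lemma poleMult_eq (f : ℂ → ℂ) (a : ℂ) : poleMult f a = (-mult f a).toNat := rfl

lemma zeroProd_eq (hf : MeromorphicNFOn f Set.univ) (E : ℂ → ℂ) (r : ℝ) (z : ℂ) :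
    zeroProd E f r z = ∏ a ∈ zeroPole f r, E (z / a) ^ zeroMult f a := by
  classical
  rw [zeroProd, finprod_eq_prod_of_mulSupport_subset (s := zeroPole f r)]
  · refine Finset.prod_congr rfl fun a ha => ?_
    obtain ⟨h1, h2, -⟩ := (mem_zeroPole hf).1 ha
    rw [finprod_eq_if, if_pos ⟨h1, h2⟩]
  · intro a ha
    rw [Function.mem_mulSupport, finprod_eq_if] at ha
    split_ifs at ha with h
    · rw [Finset.mem_coe, mem_zeroPole hf]
      refine ⟨h.1, h.2, fun h0 => ha ?_⟩
      simp [zeroMult_eq, h0]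
    · exact absurd rfl ha

lemma poleProd_eq (hf : MeromorphicNFOn f Set.univ) (E : ℂ → ℂ) (r : ℝ) (z : ℂ) :
    poleProd E f r z = ∏ a ∈ zeroPole f r, E (z / a) ^ poleMult f a := by
  classical
  rw [poleProd, finprod_eq_prod_of_mulSupport_subset (s := zeroPole f r)]
  · refine Finset.prod_congr rfl fun a ha => ?_
    obtain ⟨h1, h2, -⟩ := (mem_zeroPole hf).1 ha
    rw [finprod_eq_if, if_pos ⟨h1, h2⟩]
  · intro a ha
    rw [Function.mem_mulSupport, finprod_eq_if] at ha
    split_ifs at ha with h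
    · rw [Finset.mem_coe, mem_zeroPole hf]
      refine ⟨h.1, h.2, fun h0 => ha ?_⟩
      simp [poleMult_eq, h0]
    · exact absurd rfl ha

lemma zeroSum_eq (hf : MeromorphicNFOn f Set.univ) (r : ℝ) (z : ℂ) :
    zeroSum f r z = ∑ a ∈ zeroPole f r, (zeroMult f a : ℂ) * (1 / (z - a)) := by
  classical
  rw [zeroSum, finsum_eq_sum_of_support_subset (s := zeroPole f r)]
  · refine Finset.sum_congr rfl fun a ha => ?_
    obtain ⟨h1, h2, -⟩ := (mem_zeroPole hf).1 ha
    rw [finsum_eq_if, if_pos ⟨h1, h2⟩]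
  · intro a ha
    rw [Function.mem_support, finsum_eq_if] at ha
    split_ifs at ha with h
    · rw [Finset.mem_coe, mem_zeroPole hf]
      refine ⟨h.1, h.2, fun h0 => ha ?_⟩
      simp [zeroMult_eq, h0]
    · exact absurd rfl ha

lemma poleSum_eq (hf : MeromorphicNFOn f Set.univ) (r : ℝ) (z : ℂ) :
    poleSum f r z = ∑ a ∈ zeroPole f r, (poleMult f a : ℂ) * (1 / (z - a)) := by
  classical
  rw [poleSum, finsum_eq_sum_of_support_subset (s := zeroPole f r)]
  · refine Finset.sum_congr rfl fun a ha => ?_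
    obtain ⟨h1, h2, -⟩ := (mem_zeroPole hf).1 ha
    rw [finsum_eq_if, if_pos ⟨h1, h2⟩]
  · intro a ha
    rw [Function.mem_support, finsum_eq_if] at ha
    split_ifs at ha with h
    · rw [Finset.mem_coe, mem_zeroPole hf]
      refine ⟨h.1, h.2, fun h0 => ha ?_⟩
      simp [poleMult_eq, h0]
    · exact absurd rfl ha

/-- Combines zeros and poles into one product with signed exponents. It holds for `x = 0` too, by
the conventions for inverses. -/
lemma pow_toNat_div (x : ℂ) (n : ℤ) : x ^ n.toNat / x ^ (-n).toNat = x ^ n := by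
  rcases le_total 0 n with h | h
  · rw [Int.toNat_of_nonpos (show -n ≤ 0 by omega), pow_zero, div_one, ← zpow_natCast,
      Int.toNat_of_nonneg h]
  · rw [Int.toNat_of_nonpos h, pow_zero, ← zpow_natCast, Int.toNat_of_nonneg (by omega), zpow_neg]
    simp

lemma toNat_sub_toNat_neg (n : ℤ) : ((n.toNat : ℕ) : ℂ) - (((-n).toNat : ℕ) : ℂ) = (n : ℂ) := by
  have : ((n.toNat : ℕ) : ℤ) - (((-n).toNat : ℕ) : ℤ) = n := by omega
  exact_mod_cast congrArg (Int.cast : ℤ → ℂ) this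

lemma zeroProd_div_poleProd (hf : MeromorphicNFOn f Set.univ) (E : ℂ → ℂ) (r : ℝ) (z : ℂ) :
    zeroProd E f r z / poleProd E f r z = ∏ a ∈ zeroPole f r, E (z / a) ^ mult f a := by
  rw [zeroProd_eq hf, poleProd_eq hf, ← Finset.prod_div_distrib]
  exact Finset.prod_congr rfl fun a _ => pow_toNat_div _ _

lemma zeroSum_sub_poleSum (hf : MeromorphicNFOn f Set.univ) (r : ℝ) (z : ℂ) :
    zeroSum f r z - poleSum f r z = ∑ a ∈ zeroPole f r, (mult f a : ℂ) * (z - a)⁻¹ := by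
  rw [zeroSum_eq hf, poleSum_eq hf, ← Finset.sum_sub_distrib]
  refine Finset.sum_congr rfl fun a _ => ?_
  rw [← sub_mul, zeroMult_eq, poleMult_eq, toNat_sub_toNat_neg, one_div]

open Metric in
/-- The zero-free part of `f` in a disc without zeros and poles on its boundary. -/
theorem exists_zeroFree_part (hf : MeromorphicNFOn f Set.univ)
    (hfin : ∀ z, meromorphicOrderAt f z ≠ ⊤) (m : ℕ) {r : ℝ}
    (hr : ∀ a : ℂ, ‖a‖ = r → mult f a = 0) :
    ∃ g : ℂ → ℂ, (∀ z ∈ closedBall (0 : ℂ) r, AnalyticAt ℂ g z ∧ g z ≠ 0) ∧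
      (∀ z, 0 ≤ meromorphicOrderAt f z →
        f z = z ^ mult f 0 * (∏ a ∈ zeroPole f r, primeFactor m (z / a) ^ mult f a) * g z) ∧
      ∀ z ∈ closedBall (0 : ℂ) r, z ≠ 0 → mult f z = 0 →
        logDeriv f z = (mult f 0 : ℂ) / z +
          (∑ a ∈ zeroPole f r, (mult f a : ℂ) * (z ^ m / (a ^ m * (z - a)))) + logDeriv g z := by
  classical
  have h0 : (0 : ℂ) ∉ zeroPole f r := fun h => ((mem_zeroPole hf).1 h).1 rfl
  -- Adjoining `0`, whose factor is `z` itself, removes a possible zero or pole at the origin as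
  -- well.
  obtain ⟨g, hgN, hgo, hgeq⟩ := exists_factor (Z := insert 0 (zeroPole f r)) hf hfin
    (fun a _ z => analyticAt_factor m a z) (fun a _ z => order_factor m a z)
  have hg0 : ∀ z ∈ closedBall (0 : ℂ) r, meromorphicOrderAt g z = 0 := by
    intro z hz
    rw [hgo]
    split_ifs with hzZ
    · rfl
    · rw [Finset.mem_insert, mem_zeroPole hf, not_or] at hzZ
      rw [mem_closedBall_zero_iff] at hz
      have hm : mult f z = 0 := by
        rcases hz.lt_or_eq with h | h
        · tauto
        · exact hr z h
      rw [coe_mult (hfin z), hm]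
      rfl
  have hga : ∀ z ∈ closedBall (0 : ℂ) r, AnalyticAt ℂ g z ∧ g z ≠ 0 := fun z hz =>
    ⟨((hgN (Set.mem_univ z)).meromorphicOrderAt_nonneg_iff_analyticAt).1 (hg0 z hz).ge,
      ((hgN (Set.mem_univ z)).meromorphicOrderAt_eq_zero_iff).1 (hg0 z hz)⟩
  have hcongr : ∀ z, ∏ a ∈ zeroPole f r, factor m a z ^ mult f a
      = ∏ a ∈ zeroPole f r, primeFactor m (z / a) ^ mult f a := fun z =>
    Finset.prod_congr rfl fun a ha => by rw [factor_of_ne ((mem_zeroPole hf).1 ha).1]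
  refine ⟨g, hga, fun z hz => ?_, fun z hz hz0 hm => ?_⟩
  · have := (hgeq z hz).eq_of_nhds
    rwa [Finset.prod_insert h0, hcongr, factor_zero] at this
  · have hzZ : ∀ a ∈ insert 0 (zeroPole f r), z ≠ a := by
      rintro a ha rfl
      rcases Finset.mem_insert.1 ha with h | h
      · exact hz0 h
      · exact ((mem_zeroPole hf).1 h).2.2 hm
    rw [logDeriv_factor (fun a _ z => analyticAt_factor m a z)
      (fun a ha => factor_ne_zero m (hzZ a ha)) (hga z hz).1 (hga z hz).2
      (hgeq z (by rw [coe_mult (hfin z), hm]; rfl)), Finset.sum_insert h0, logDeriv_factor_zero,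
      mul_one_div]
    congr 2
    refine Finset.sum_congr rfl fun a ha => ?_
    rw [logDeriv_primeFactor m ((mem_zeroPole hf).1 ha).1 (hzZ a (Finset.mem_insert_of_mem ha))]

end Products

end Yosida

/-! ### Contour integrals with Cauchy kernels -/

namespace Yosida

open Metric

/-- The residues at `a` and `z` cancel, and for `a = z` the double pole has residue zero. Hence
polar terms inside the circle drop out of the remainder integral. -/
lemma circleIntegral_inv_mul_inv_eq_zero {r : ℝ} (hr : 0 < r) {a z : ℂ} (ha : ‖a‖ < r)
    (hz : ‖z‖ < r) : (∮ w in C(0, r), (w - a)⁻¹ * (w - z)⁻¹) = 0 := by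
  have hne : ∀ c : ℂ, ‖c‖ < r → ∀ w ∈ sphere (0 : ℂ) r, w - c ≠ 0 := by
    intro c hc w hw h
    rw [sub_eq_zero.1 h, mem_sphere_zero_iff_norm] at hw
    linarith
  have hci : ∀ c : ℂ, ‖c‖ < r → CircleIntegrable (fun w => (w - c)⁻¹) 0 r := fun c hc =>
    ContinuousOn.circleIntegrable hr.le fun w hw =>
      ContinuousAt.continuousWithinAt (by have := hne c hc w hw; fun_prop (disch := assumption))
  by_cases haz : a = z
  · subst haz
    have h : (∮ w in C(0, r), (w - a) ^ (-2 : ℤ)) = 0 :=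
      circleIntegral.integral_sub_zpow_of_ne (by norm_num) 0 a r
    refine Eq.trans (circleIntegral.integral_congr hr.le fun w _ => ?_) h
    simp only [zpow_neg]
    rw [← mul_inv, ← sq]
    rfl
  · have haz' : a - z ≠ 0 := sub_ne_zero.2 haz
    rw [circleIntegral.integral_congr hr.le
      (g := fun w => (a - z)⁻¹ * ((w - a)⁻¹ - (w - z)⁻¹)), circleIntegral.integral_const_mul,
      circleIntegral.integral_sub (hci a ha) (hci z hz),
      circleIntegral.integral_sub_inv_of_mem_ball (mem_ball_zero_iff.2 ha),
      circleIntegral.integral_sub_inv_of_mem_ball (mem_ball_zero_iff.2 hz)]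
    · simp
    · intro w hw
      have h1 := hne a ha w hw
      have h2 := hne z hz w hw
      field_simp
      ring

lemma circleIntegral_pow_inv_mul_inv_eq_zero {r : ℝ} (hr : 0 < r) {z : ℂ} (hz : ‖z‖ < r) (j : ℕ) :
    (∮ w in C(0, r), (w ^ (j + 1))⁻¹ * (w - z)⁻¹) = 0 := by
  have hne : ∀ c : ℂ, ‖c‖ < r → ∀ w ∈ sphere (0 : ℂ) r, w - c ≠ 0 := by
    intro c hc w hw h
    rw [sub_eq_zero.1 h, mem_sphere_zero_iff_norm] at hw
    linarith
  have hw0 : ∀ w ∈ sphere (0 : ℂ) r, w ≠ 0 := fun w hw => by simpa using hne 0 (by simpa) w hw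
  have hpow : ∀ j : ℕ, (∮ w in C(0, r), (w ^ (j + 2))⁻¹) = 0 := by
    intro j
    have h : (∮ w in C(0, r), (w - 0) ^ (-(j + 2) : ℤ)) = 0 :=
      circleIntegral.integral_sub_zpow_of_ne (by omega) 0 0 r
    refine Eq.trans (circleIntegral.integral_congr hr.le fun w _ => ?_) h
    simp only [zpow_neg, sub_zero]
    norm_cast
  induction j with
  | zero => simpa using circleIntegral_inv_mul_inv_eq_zero hr (a := 0) (by simpa) hz
  | succ j ih =>
    by_cases hz0 : z = 0
    · subst hz0
      refine Eq.trans (circleIntegral.integral_congr hr.le fun w hw => ?_) (hpow (j + 1))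
      simp only [sub_zero]
      rw [← mul_inv, ← pow_succ]
    -- Induction by `w^(-j-2)(w-z)^(-1) = z^(-1)(w^(-j-1)(w-z)^(-1) - w^(-j-2))`; the last power has
    -- a primitive.
    · rw [circleIntegral.integral_congr hr.le
        (g := fun w => z⁻¹ * ((w ^ (j + 1))⁻¹ * (w - z)⁻¹ - (w ^ (j + 2))⁻¹)),
        circleIntegral.integral_const_mul, circleIntegral.integral_sub, ih, hpow]
      · simp
      · exact ContinuousOn.circleIntegrable hr.le fun w hw => ContinuousAt.continuousWithinAt (by
          have := hne z hz w hw
          have := pow_ne_zero (j + 1) (hw0 w hw)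
          fun_prop (disch := assumption))
      · exact ContinuousOn.circleIntegrable hr.le fun w hw => ContinuousAt.continuousWithinAt (by
          have := pow_ne_zero (j + 2) (hw0 w hw)
          fun_prop (disch := assumption))
      · intro w hw
        have h1 := hne z hz w hw
        have h2 := hw0 w hw
        field_simp
        ring

/-- Cauchy's integral formula with the Taylor remainder. -/
lemma eq_taylor_add_circleIntegral {r : ℝ} (hr : 0 < r) {G : ℂ → ℂ}
    (hG : ∀ z ∈ closedBall (0 : ℂ) r, AnalyticAt ℂ G z) (m : ℕ) {z : ℂ} (hz : ‖z‖ < r) :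
    G z = (∑ k ∈ Finset.range m,
        (2 * Real.pi * Complex.I)⁻¹ * (∮ w in C(0, r), G w * (w ^ (k + 1))⁻¹) * z ^ k)
      + (2 * Real.pi * Complex.I)⁻¹ * z ^ m * ∮ w in C(0, r), G w * ((w ^ m)⁻¹ * (w - z)⁻¹) := by
  have hne : ∀ w ∈ sphere (0 : ℂ) r, w - z ≠ 0 := by
    intro w hw h
    rw [sub_eq_zero.1 h, mem_sphere_zero_iff_norm] at hw
    linarith
  have hw0 : ∀ w ∈ sphere (0 : ℂ) r, w ≠ 0 := by
    rintro w hw rfl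
    simp at hw
    linarith
  have hcG : ∀ w ∈ sphere (0 : ℂ) r, ContinuousAt G w := fun w hw =>
    (hG w (sphere_subset_closedBall hw)).continuousAt
  have hci1 : ∀ k : ℕ, CircleIntegrable (fun w => G w * (w ^ (k + 1))⁻¹) 0 r := fun k =>
    ContinuousOn.circleIntegrable hr.le fun w hw => ContinuousAt.continuousWithinAt (by
      have := hcG w hw
      have := pow_ne_zero (k + 1) (hw0 w hw)
      fun_prop (disch := assumption))
  have hci2 : ∀ k : ℕ, CircleIntegrable (fun w => G w * ((w ^ k)⁻¹ * (w - z)⁻¹)) 0 r := fun k =>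
    ContinuousOn.circleIntegrable hr.le fun w hw => ContinuousAt.continuousWithinAt (by
      have := hcG w hw
      have := pow_ne_zero k (hw0 w hw)
      have := hne w hw
      fun_prop (disch := assumption))
  induction m with
  | zero =>
    have := Complex.two_pi_I_inv_smul_circleIntegral_sub_inv_smul_of_differentiable_on_off_countable
      Set.countable_empty (mem_ball_zero_iff.2 hz)
      (fun w hw => (hG w hw).continuousAt.continuousWithinAt)
      (fun w hw => (hG w (ball_subset_closedBall hw.1)).differentiableAt)
    rw [← this]
    simp [mul_comm]
  | succ m ih =>
    rw [Finset.sum_range_succ, ih, add_assoc]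
    congr 1
    -- Uses `1/(w-z) = 1/w + z/(w(w-z))`.
    have : (∮ w in C(0, r), G w * ((w ^ m)⁻¹ * (w - z)⁻¹))
        = (∮ w in C(0, r), G w * (w ^ (m + 1))⁻¹)
          + z * ∮ w in C(0, r), G w * ((w ^ (m + 1))⁻¹ * (w - z)⁻¹) := by
      have hci3 : CircleIntegrable (fun w => z * (G w * ((w ^ (m + 1))⁻¹ * (w - z)⁻¹))) 0 r :=
        (hci2 (m + 1)).const_mul z
      rw [← circleIntegral.integral_const_mul, ← circleIntegral.integral_add (hci1 m) hci3]
      refine circleIntegral.integral_congr hr.le fun w hw => ?_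
      have h1 := hne w hw
      have h2 := hw0 w hw
      field_simp
      ring
    rw [this]
    ring

end Yosida

/-! ### Exponential representation in discs bounded by good circles -/

namespace Yosida

open Metric

variable {f : ℂ → ℂ}

/-- The Taylor coefficients at the origin of the regular part of `f' / f`. -/
noncomputable def logCoeff (f : ℂ → ℂ) (η : ℝ) (k : ℕ) : ℂ :=
  (2 * Real.pi * Complex.I)⁻¹ *
    ∮ w in C(0, η), (logDeriv f w - (mult f 0 : ℂ) / w) * (w ^ (k + 1))⁻¹

lemma analyticAt_logDeriv {z : ℂ} (ha : AnalyticAt ℂ f z) (h0 : f z ≠ 0) :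
    AnalyticAt ℂ (logDeriv f) z := ha.deriv.div ha h0

lemma analyticAt_of_mult_eq_zero (hf : MeromorphicNFOn f Set.univ)
    (hfin : ∀ z, meromorphicOrderAt f z ≠ ⊤) {z : ℂ} (h : mult f z = 0) :
    AnalyticAt ℂ f z ∧ f z ≠ 0 := by
  have h0 : meromorphicOrderAt f z = 0 := by rw [coe_mult (hfin z), h]; rfl
  have hz := hf (Set.mem_univ z)
  exact ⟨hz.meromorphicOrderAt_nonneg_iff_analyticAt.1 h0.ge,
    hz.meromorphicOrderAt_eq_zero_iff.1 h0⟩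

/-- The lower Taylor coefficients of `g'/g` do not depend on `r`: `g'/g` differs from the regular
part of `f'/f` by a sum divisible by `w^m`. After division by `w^(k+1)` with `k < m` that sum is
still holomorphic in the small disc. -/
lemma circleIntegral_zeroFree_part_coeff (hf : MeromorphicNFOn f Set.univ)
    {m k : ℕ} (hk : k < m) {η r : ℝ} (hη0 : 0 < η) (hηr : η < r)
    (hη : ∀ a : ℂ, a ≠ 0 → ‖a‖ ≤ η → mult f a = 0) {g : ℂ → ℂ}
    (hg : ∀ z ∈ closedBall (0 : ℂ) r, AnalyticAt ℂ g z ∧ g z ≠ 0)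
    (hlog : ∀ z ∈ closedBall (0 : ℂ) r, z ≠ 0 → mult f z = 0 →
        logDeriv f z = (mult f 0 : ℂ) / z +
          (∑ a ∈ zeroPole f r, (mult f a : ℂ) * (z ^ m / (a ^ m * (z - a)))) + logDeriv g z) :
    (2 * Real.pi * Complex.I)⁻¹ * (∮ w in C(0, r), logDeriv g w * (w ^ (k + 1))⁻¹)
      = logCoeff f η k := by
  have hG : ∀ z ∈ closedBall (0 : ℂ) r, AnalyticAt ℂ (logDeriv g) z := fun z hz =>
    analyticAt_logDeriv (hg z hz).1 (hg z hz).2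
  have hGd : ∀ z ∈ closedBall (0 : ℂ) r, z ≠ 0 →
      DifferentiableAt ℂ (fun w => logDeriv g w * (w ^ (k + 1))⁻¹) z := by
    intro z hz hz0
    have h1 := (hG z hz).differentiableAt
    have h2 := pow_ne_zero (k + 1) hz0
    fun_prop (disch := assumption)
  rw [logCoeff, Complex.circleIntegral_eq_of_differentiable_on_annulus_off_countable hη0 hηr.le
    Set.countable_empty]
  rotate_left
  · rintro z ⟨hz, hz'⟩
    refine (hGd z hz ?_).continuousAt.continuousWithinAt
    rintro rfl
    exact hz' (mem_ball_self hη0)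
  · rintro z ⟨⟨hz, hz'⟩, -⟩
    refine hGd z (ball_subset_closedBall hz) ?_
    rintro rfl
    exact hz' (mem_closedBall_self hη0.le)
  congr 1
  set q : ℂ → ℂ := fun w =>
    ∑ a ∈ zeroPole f r, (mult f a : ℂ) * (w ^ (m - (k + 1)) / (a ^ m * (w - a))) with hq
  have hqd : ∀ w ∈ closedBall (0 : ℂ) η, DifferentiableAt ℂ q w := by
    intro w hw
    refine DifferentiableAt.fun_sum fun a ha => ?_
    obtain ⟨ha0, -, ham⟩ := (mem_zeroPole hf).1 ha
    have h1 : a ^ m * (w - a) ≠ 0 := by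
      refine mul_ne_zero (pow_ne_zero _ ha0) (sub_ne_zero.2 ?_)
      rintro rfl
      exact ham (hη _ ha0 (mem_closedBall_zero_iff.1 hw))
    fun_prop (disch := assumption)
  have hq0 : (∮ w in C(0, η), q w) = 0 :=
    Complex.circleIntegral_eq_zero_of_differentiable_on_off_countable hη0.le Set.countable_empty
      (fun w hw => (hqd w hw).continuousAt.continuousWithinAt)
      (fun w hw => hqd w (ball_subset_closedBall hw.1))
  have hw0 : ∀ w ∈ sphere (0 : ℂ) η, w ≠ 0 := by
    rintro w hw rfl
    simp at hw
    linarith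
  have hsub : ∀ w ∈ sphere (0 : ℂ) η, w ∈ closedBall (0 : ℂ) r := fun w hw => by
    rw [mem_sphere_zero_iff_norm] at hw
    rw [mem_closedBall_zero_iff]
    linarith
  have hci : CircleIntegrable (fun w => logDeriv g w * (w ^ (k + 1))⁻¹) 0 η :=
    ContinuousOn.circleIntegrable hη0.le fun w hw =>
      (hGd w (hsub w hw) (hw0 w hw)).continuousAt.continuousWithinAt
  have hciq : CircleIntegrable q 0 η := ContinuousOn.circleIntegrable hη0.le fun w hw =>
    (hqd w (sphere_subset_closedBall hw)).continuousAt.continuousWithinAt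
  have key : (∮ w in C(0, η), logDeriv g w * (w ^ (k + 1))⁻¹)
      = ∮ w in C(0, η), (logDeriv g w * (w ^ (k + 1))⁻¹ + q w) := by
    rw [circleIntegral.integral_add hci hciq, hq0, add_zero]
  refine key.trans (circleIntegral.integral_congr hη0.le fun w hw => ?_)
  have hwn := hw0 w hw
  have hpow : w ^ (m - (k + 1)) = w ^ m * (w ^ (k + 1))⁻¹ := by
    rw [pow_sub₀ w hwn (by omega)]
  have hsum : q w = (∑ a ∈ zeroPole f r, (mult f a : ℂ) * (w ^ m / (a ^ m * (w - a))))
      * (w ^ (k + 1))⁻¹ := by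
    rw [hq, Finset.sum_mul]
    refine Finset.sum_congr rfl fun a _ => ?_
    rw [hpow]
    ring
  rw [hsum, hlog w (hsub w hw) hwn (hη w hwn (by rw [mem_sphere_zero_iff_norm] at hw; exact hw.le))]
  ring

/-- In the Taylor remainder `g'/g` may be replaced by `f'/f`, since the subtracted terms integrate
to zero against the kernel. Only `f'/f` is controlled on the circle. The splitting `1/(w-z) = 1/w +
z/(w(w-z))` isolates the coefficient that decides between `m > β` and `m = β`. -/
lemma circleIntegral_zeroFree_part (hf : MeromorphicNFOn f Set.univ)
    (hfin : ∀ z, meromorphicOrderAt f z ≠ ⊤) (m : ℕ) {r : ℝ} (hr0 : 0 < r)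
    (hr : ∀ a : ℂ, ‖a‖ = r → mult f a = 0) {g : ℂ → ℂ}
    (hlog : ∀ z ∈ closedBall (0 : ℂ) r, z ≠ 0 → mult f z = 0 →
        logDeriv f z = (mult f 0 : ℂ) / z +
          (∑ a ∈ zeroPole f r, (mult f a : ℂ) * (z ^ m / (a ^ m * (z - a)))) + logDeriv g z)
    {z : ℂ} (hz : ‖z‖ < r) :
    (∮ w in C(0, r), logDeriv g w * ((w ^ m)⁻¹ * (w - z)⁻¹))
      = (∮ w in C(0, r), logDeriv f w * (w ^ (m + 1))⁻¹)
        + z * ∮ w in C(0, r), logDeriv f w * ((w ^ (m + 1))⁻¹ * (w - z)⁻¹) := by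
  have hne : ∀ c : ℂ, ‖c‖ < r → ∀ w ∈ sphere (0 : ℂ) r, w - c ≠ 0 := by
    intro c hc w hw h
    rw [sub_eq_zero.1 h, mem_sphere_zero_iff_norm] at hw
    linarith
  have hw0 : ∀ w ∈ sphere (0 : ℂ) r, w ≠ 0 := fun w hw => by simpa using hne 0 (by simpa) w hw
  have hL : ∀ w ∈ sphere (0 : ℂ) r, ContinuousAt (logDeriv f) w := fun w hw => by
    have := analyticAt_of_mult_eq_zero hf hfin (hr w (mem_sphere_zero_iff_norm.1 hw))
    exact (analyticAt_logDeriv this.1 this.2).continuousAt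
  have hci1 : CircleIntegrable (fun w => logDeriv f w * (w ^ (m + 1))⁻¹) 0 r :=
    ContinuousOn.circleIntegrable hr0.le fun w hw => ContinuousAt.continuousWithinAt (by
      have := hL w hw
      have := pow_ne_zero (m + 1) (hw0 w hw)
      fun_prop (disch := assumption))
  have hci2 : CircleIntegrable (fun w => z * (logDeriv f w * ((w ^ (m + 1))⁻¹ * (w - z)⁻¹))) 0 r :=
    ContinuousOn.circleIntegrable hr0.le fun w hw => ContinuousAt.continuousWithinAt (by
      have := hL w hw
      have := pow_ne_zero (m + 1) (hw0 w hw)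
      have := hne z hz w hw
      fun_prop (disch := assumption))
  have hci3 : CircleIntegrable (fun w => (mult f 0 : ℂ) * ((w ^ (m + 1))⁻¹ * (w - z)⁻¹)) 0 r :=
    ContinuousOn.circleIntegrable hr0.le fun w hw => ContinuousAt.continuousWithinAt (by
      have := pow_ne_zero (m + 1) (hw0 w hw)
      have := hne z hz w hw
      fun_prop (disch := assumption))
  have hci4 : ∀ a ∈ zeroPole f r, CircleIntegrable
      (fun w => ((mult f a : ℂ) / a ^ m) * ((w - a)⁻¹ * (w - z)⁻¹)) 0 r := fun a ha =>
    ContinuousOn.circleIntegrable hr0.le fun w hw => ContinuousAt.continuousWithinAt (by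
      have := hne a ((mem_zeroPole hf).1 ha).2.1 w hw
      have := hne z hz w hw
      fun_prop (disch := assumption))
  have h3 : (∮ w in C(0, r), (mult f 0 : ℂ) * ((w ^ (m + 1))⁻¹ * (w - z)⁻¹)) = 0 := by
    rw [circleIntegral.integral_const_mul, circleIntegral_pow_inv_mul_inv_eq_zero hr0 hz, mul_zero]
  have h4 : (∮ w in C(0, r), ∑ a ∈ zeroPole f r,
      ((mult f a : ℂ) / a ^ m) * ((w - a)⁻¹ * (w - z)⁻¹)) = 0 := by
    rw [circleIntegral.integral_fun_sum hci4]
    refine Finset.sum_eq_zero fun a ha => ?_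
    rw [circleIntegral.integral_const_mul,
      circleIntegral_inv_mul_inv_eq_zero hr0 ((mem_zeroPole hf).1 ha).2.1 hz, mul_zero]
  have key : (∮ w in C(0, r), logDeriv g w * ((w ^ m)⁻¹ * (w - z)⁻¹))
      = (∮ w in C(0, r), logDeriv f w * (w ^ (m + 1))⁻¹)
        + (∮ w in C(0, r), z * (logDeriv f w * ((w ^ (m + 1))⁻¹ * (w - z)⁻¹)))
        - (∮ w in C(0, r), (mult f 0 : ℂ) * ((w ^ (m + 1))⁻¹ * (w - z)⁻¹))
        - ∮ w in C(0, r), ∑ a ∈ zeroPole f r,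
            ((mult f a : ℂ) / a ^ m) * ((w - a)⁻¹ * (w - z)⁻¹) := by
    have hci12 : CircleIntegrable (fun w => logDeriv f w * (w ^ (m + 1))⁻¹ +
      z * (logDeriv f w * ((w ^ (m + 1))⁻¹ * (w - z)⁻¹))) 0 r := CircleIntegrable.add hci1 hci2
    have hci123 : CircleIntegrable (fun w => logDeriv f w * (w ^ (m + 1))⁻¹ +
      z * (logDeriv f w * ((w ^ (m + 1))⁻¹ * (w - z)⁻¹)) -
      (mult f 0 : ℂ) * ((w ^ (m + 1))⁻¹ * (w - z)⁻¹)) 0 r := CircleIntegrable.sub hci12 hci3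
    rw [← circleIntegral.integral_add hci1 hci2, ← circleIntegral.integral_sub hci12 hci3,
      ← circleIntegral.integral_sub hci123 (CircleIntegrable.fun_sum _ hci4)]
    refine circleIntegral.integral_congr hr0.le fun w hw => ?_
    have h5 := hlog w (sphere_subset_closedBall hw) (hw0 w hw)
      (hr w (mem_sphere_zero_iff_norm.1 hw))
    have hwn := hw0 w hw
    have hwz := hne z hz w hw
    have hsum : ∑ a ∈ zeroPole f r, ((mult f a : ℂ) / a ^ m) * ((w - a)⁻¹ * (w - z)⁻¹)
        = (∑ a ∈ zeroPole f r, (mult f a : ℂ) * (w ^ m / (a ^ m * (w - a))))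
          * ((w ^ m)⁻¹ * (w - z)⁻¹) := by
      rw [Finset.sum_mul]
      refine Finset.sum_congr rfl fun a ha => ?_
      have h6 := hne a ((mem_zeroPole hf).1 ha).2.1 w hw
      have h7 := ((mem_zeroPole hf).1 ha).1
      field_simp
    have h8 : logDeriv g w = logDeriv f w - (mult f 0 : ℂ) / w -
        ∑ a ∈ zeroPole f r, (mult f a : ℂ) * (w ^ m / (a ^ m * (w - a))) := by
      rw [h5]; ring
    rw [hsum, h8]
    field_simp
    ring_nf
  rw [key, h3, h4, sub_zero, sub_zero, circleIntegral.integral_const_mul]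

/-- The representation of `f` in a disc whose boundary circle is good for `f' / f`. -/
theorem exists_exp_representation (hf : MeromorphicNFOn f Set.univ)
    (hfin : ∀ z, meromorphicOrderAt f z ≠ ⊤) (m : ℕ) {η r β C : ℝ} (hη0 : 0 < η) (hηr : η < r)
    (hη : ∀ a : ℂ, a ≠ 0 → ‖a‖ ≤ η → mult f a = 0)
    (hr : ∀ a : ℂ, ‖a‖ = r → mult f a = 0)
    (hint : ∀ (k : ℂ → ℂ) (B : ℝ), 0 ≤ B → (∀ z ∈ sphere (0 : ℂ) r, ‖k z‖ ≤ B) →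
          ‖∮ z in C(0, r), logDeriv f z * k z‖ ≤ B * (C * r ^ (1 + β)))
    {ℓ : ℂ} (hℓ : Tendsto (fun z => f z * z ^ (-mult f 0)) (𝓝[≠] 0) (𝓝 (Complex.exp ℓ))) :
    ∃ (γ : ℂ) (ε : ℂ → ℂ), ‖γ‖ ≤ C * r ^ (β - m) ∧
      (∀ z, ‖z‖ ≤ r / 2 → ‖ε z‖ ≤ 2 * C * r ^ (β - m - 1) * ‖z‖ ^ (m + 2)) ∧
      ∀ z, ‖z‖ < r → 0 ≤ meromorphicOrderAt f z →
        f z = z ^ mult f 0 * (∏ a ∈ zeroPole f r, primeFactor m (z / a) ^ mult f a) *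
          Complex.exp (ℓ + (∑ k ∈ Finset.range m, logCoeff f η k * (z ^ (k + 1) / (k + 1 : ℂ)))
            + γ * (z ^ (m + 1) / (m + 1 : ℂ)) + ε z) := by
  have hr0 : 0 < r := hη0.trans hηr
  obtain ⟨g, hg, hfg, hlog⟩ := exists_zeroFree_part hf hfin m hr
  set γ : ℂ := (2 * Real.pi * Complex.I)⁻¹ * ∮ w in C(0, r), logDeriv f w * (w ^ (m + 1))⁻¹ with hγ
  set I : ℂ → ℂ := fun z => (2 * Real.pi * Complex.I)⁻¹ *
    ∮ w in C(0, r), logDeriv f w * ((w ^ (m + 1))⁻¹ * (w - z)⁻¹) with hI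
  have hG : ∀ z ∈ closedBall (0 : ℂ) r, AnalyticAt ℂ (logDeriv g) z := fun z hz =>
    analyticAt_logDeriv (hg z hz).1 (hg z hz).2
  have hexp : ∀ z, ‖z‖ < r → logDeriv g z = (∑ k ∈ Finset.range m, logCoeff f η k * z ^ k)
      + γ * z ^ m + z ^ (m + 1) * I z := by
    intro z hz
    rw [eq_taylor_add_circleIntegral hr0 hG m hz, Finset.sum_congr rfl fun k hk => by
      rw [circleIntegral_zeroFree_part_coeff hf (Finset.mem_range.1 hk) hη0 hηr hη hg hlog],
      circleIntegral_zeroFree_part hf hfin m hr0 hr hlog hz, hγ, hI]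
    ring
  have h2π : ‖(2 * Real.pi * Complex.I : ℂ)⁻¹‖ ≤ 1 := by
    rw [norm_inv]
    refine inv_le_one_of_one_le₀ ?_
    simp only [norm_mul, Complex.norm_ofNat, Complex.norm_real, Complex.norm_I, mul_one,
      Real.norm_eq_abs, abs_of_pos Real.pi_pos]
    linarith [Real.pi_gt_three]
  have hpow1 : r ^ (β - m) = (r ^ (m + 1))⁻¹ * r ^ (1 + β) := by
    rw [← Real.rpow_natCast, ← Real.rpow_neg hr0.le, ← Real.rpow_add hr0]
    congr 1
    push_cast
    ring
  have hpow2 : r ^ (β - m - 1) = (r ^ (m + 1))⁻¹ * r⁻¹ * r ^ (1 + β) := by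
    rw [Real.rpow_sub_one hr0.ne', hpow1]
    ring
  have hγb : ‖γ‖ ≤ C * r ^ (β - m) := by
    rw [hγ, norm_mul, hpow1]
    have := hint (fun w => (w ^ (m + 1))⁻¹) (r ^ (m + 1))⁻¹ (by positivity) (fun w hw => by
      rw [norm_inv, norm_pow, mem_sphere_zero_iff_norm.1 hw])
    calc _ ≤ 1 * ((r ^ (m + 1))⁻¹ * (C * r ^ (1 + β))) := by gcongr
      _ = _ := by ring
  have hIb : ∀ z, ‖z‖ ≤ r / 2 → ‖I z‖ ≤ 2 * C * r ^ (β - m - 1) := by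
    intro z hz
    rw [hI, norm_mul, hpow2]
    have := hint (fun w => (w ^ (m + 1))⁻¹ * (w - z)⁻¹) ((r ^ (m + 1))⁻¹ * (2 * r⁻¹))
      (by positivity) (fun w hw => by
        rw [mem_sphere_zero_iff_norm] at hw
        rw [norm_mul, norm_inv, norm_pow, hw, norm_inv]
        have h1 := norm_sub_norm_le w z
        have h2 : r / 2 ≤ ‖w - z‖ := by linarith
        have h3 : 2 * r⁻¹ = (r / 2)⁻¹ := by rw [inv_div]; ring
        rw [h3]
        gcongr)
    calc _ ≤ 1 * ((r ^ (m + 1))⁻¹ * (2 * r⁻¹) * (C * r ^ (1 + β))) := by gcongr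
      _ = _ := by ring
  -- All prime factors equal `1` at `0`, so `g 0` is the leading coefficient of `f` at `0`, and the
  -- constant term `ℓ` does not depend on `r`.
  have hg00 : g 0 = Complex.exp ℓ := by
    have hev : ∀ᶠ z in 𝓝[≠] (0 : ℂ), f z * z ^ (-mult f 0)
        = (∏ a ∈ zeroPole f r, primeFactor m (z / a) ^ mult f a) * g z := by
      filter_upwards [(hf (Set.mem_univ 0)).meromorphicAt.eventually_analyticAt,
        self_mem_nhdsWithin] with z hz hz0
      have hz0' : z ≠ 0 := hz0
      rw [hfg z hz.meromorphicOrderAt_nonneg, zpow_neg]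
      have := zpow_ne_zero (mult f 0) hz0'
      field_simp
    have hcont : ContinuousAt
        (fun z => (∏ a ∈ zeroPole f r, primeFactor m (z / a) ^ mult f a) * g z) 0 := by
      refine ContinuousAt.mul ?_ (hg 0 (mem_closedBall_self hr0.le)).1.continuousAt
      refine tendsto_finsetProd _ fun a _ => ?_
      refine ContinuousAt.zpow₀ (f := fun z => primeFactor m (z / a)) ?_ _ (Or.inl ?_)
      · exact ContinuousAt.comp (f := fun z => z / a) (analyticAt_primeFactor m _).continuousAt
          (by fun_prop)
      · simp [primeFactor_zero]
    have h1 := (hcont.tendsto.mono_left nhdsWithin_le_nhds).congr' (hev.mono fun _ h => h.symm)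
    have h2 := tendsto_nhds_unique h1 hℓ
    simpa [primeFactor_zero] using h2
  obtain ⟨L, hL0, hL⟩ := (DifferentiableOn.isExactOn_ball (c := (0 : ℂ)) (r := r)
    (f := logDeriv g) fun z hz =>
      (hG z (ball_subset_closedBall hz)).differentiableAt.differentiableWithinAt).with_val_at 0 ℓ
  -- `g exp(-L)` has derivative zero and equals `1` at the origin.
  have hgL : ∀ z ∈ ball (0 : ℂ) r, g z = Complex.exp (L z) := by
    have hd : ∀ z ∈ ball (0 : ℂ) r, HasDerivWithinAt (fun z => g z * Complex.exp (-L z)) 0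
        (ball 0 r) z := by
      intro z hz
      obtain ⟨h1, h2⟩ := hg z (ball_subset_closedBall hz)
      have h3 := h1.differentiableAt.hasDerivAt.mul (hL z hz).neg.cexp
      refine (h3.congr_deriv ?_).hasDerivWithinAt
      rw [logDeriv_apply]
      field_simp
      ring
    intro z hz
    have h1 := (convex_ball (0 : ℂ) r).norm_image_sub_le_of_norm_hasDerivWithin_le hd
      (C := 0) (by simp) (mem_ball_self hr0) hz
    rw [zero_mul, norm_le_zero_iff, sub_eq_zero, hL0, hg00, ← Complex.exp_add, add_neg_cancel,
      Complex.exp_zero, Complex.exp_neg] at h1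
    field_simp at h1
    exact h1
  set P : ℂ → ℂ := fun z => ℓ + (∑ k ∈ Finset.range m, logCoeff f η k * (z ^ (k + 1) / (k + 1 : ℂ)))
    + γ * (z ^ (m + 1) / (m + 1 : ℂ)) with hP
  have hmon : ∀ (k : ℕ) (z : ℂ), HasDerivAt (fun z : ℂ => z ^ (k + 1) / (k + 1 : ℂ)) (z ^ k) z := by
    intro k z
    have h := ((hasDerivAt_id' z).fun_pow (k + 1)).div_const (k + 1 : ℂ)
    refine h.congr_deriv ?_
    have : (k + 1 : ℂ) ≠ 0 := by exact_mod_cast k.succ_ne_zero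
    push_cast
    field_simp
  have hPd : ∀ z, HasDerivAt P ((∑ k ∈ Finset.range m, logCoeff f η k * z ^ k) + γ * z ^ m) z := by
    intro z
    exact ((HasDerivAt.fun_sum fun k _ => (hmon k z).const_mul _).const_add ℓ).add
      ((hmon m z).const_mul γ)
  have hεd : ∀ z ∈ ball (0 : ℂ) r, HasDerivAt (fun z => L z - P z) (z ^ (m + 1) * I z) z := by
    intro z hz
    refine ((hL z hz).sub (hPd z)).congr_deriv ?_
    rw [hexp z (mem_ball_zero_iff.1 hz)]
    ring
  refine ⟨γ, fun z => L z - P z, hγb, fun z hz => ?_, fun z hz hnn => ?_⟩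
  -- The mean value inequality on the disc of radius `‖z‖`, with derivative `w^(m+1) I(w)`, produces
  -- the exponent `m + 2`.
  · have hsub : closedBall (0 : ℂ) ‖z‖ ⊆ ball 0 r := closedBall_subset_ball (by linarith)
    have h1 := (convex_closedBall (0 : ℂ) ‖z‖).norm_image_sub_le_of_norm_hasDerivWithin_le
      (fun w hw => (hεd w (hsub hw)).hasDerivWithinAt)
      (C := ‖z‖ ^ (m + 1) * (2 * C * r ^ (β - m - 1))) (fun w hw => by
        rw [mem_closedBall_zero_iff] at hw
        rw [norm_mul, norm_pow]
        gcongr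
        exact hIb w (hw.trans hz))
      (mem_closedBall_self (norm_nonneg z)) (mem_closedBall_zero_iff.2 le_rfl)
    have hP0 : P 0 = ℓ := by simp [hP]
    rw [hL0, hP0, sub_self, sub_zero, sub_zero] at h1
    refine h1.trans (le_of_eq ?_)
    ring
  · rw [hfg z hnn, hgL z (mem_ball_zero_iff.2 hz)]
    congr 2
    simp only [hP]
    ring

end Yosida

/-! ### Passing to the limit along radii -/

namespace Yosida

open Metric

/-- The logarithm of the prime factor is the Taylor remainder of `log (1 - u)` after degree `m`. -/
lemma primeFactor_eq_exp (m : ℕ) {u : ℂ} (hu : ‖u‖ ≤ 1 / 2) :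
    ∃ t : ℂ, primeFactor m u = Complex.exp t ∧ ‖t‖ ≤ 2 * ‖u‖ ^ (m + 1) := by
  have h1 : 1 - u ≠ 0 := by
    intro h
    rw [← sub_eq_zero.1 h] at hu
    norm_num at hu
  refine ⟨Complex.log (1 - u) + ∑ j ∈ Finset.Icc 1 m, u ^ j / (j : ℂ), ?_, ?_⟩
  · rw [Complex.exp_add, Complex.exp_log h1, primeFactor]
  · have h2 : Complex.logTaylor (m + 1) (-u) = -∑ j ∈ Finset.Icc 1 m, u ^ j / (j : ℂ) := by
      have hI : Finset.Icc 1 m = Finset.Ico 1 (m + 1) := by ext; simp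
      rw [Complex.logTaylor, Finset.range_eq_Ico, Finset.sum_eq_sum_Ico_succ_bot (by omega), hI,
        ← Finset.sum_neg_distrib]
      simp only [Nat.cast_zero, div_zero, zero_add]
      refine Finset.sum_congr rfl fun j _ => ?_
      rw [neg_pow u, ← mul_assoc, ← pow_add, show j + 1 + j = 2 * j + 1 by ring, pow_succ, pow_mul]
      simp [neg_div]
    have h3 := Complex.norm_log_sub_logTaylor_le m (z := -u) (by rw [norm_neg]; linarith)
    rw [h2, sub_neg_eq_add, ← sub_eq_add_neg, norm_neg] at h3
    refine h3.trans ?_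
    have h4 : (1 - ‖u‖)⁻¹ ≤ 2 := by
      rw [inv_le_comm₀ (by linarith) (by norm_num)]
      linarith
    rw [div_le_iff₀ (by positivity)]
    have h5 : 0 ≤ ‖u‖ ^ (m + 1) := by positivity
    have h6 : (0 : ℝ) ≤ m := Nat.cast_nonneg m
    have h7 : ‖u‖ ^ (m + 1) * (1 - ‖u‖)⁻¹ ≤ ‖u‖ ^ (m + 1) * 2 := by gcongr
    nlinarith [mul_nonneg h5 h6]

/-- Measures the effect of adding the factors of an annulus, in order to pass from a good radius to
an arbitrary one. -/
lemma prod_primeFactor_eq_exp (m : ℕ) (n : ℂ → ℤ) (Z : Finset ℂ) {z : ℂ} {r K : ℝ} (hr : 0 < r)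
    (hZ : ∀ a ∈ Z, r ≤ ‖a‖) (hz : ‖z‖ ≤ K) (hK : K ≤ r / 2) :
    ∃ t : ℂ, ∏ a ∈ Z, primeFactor m (z / a) ^ n a = Complex.exp t ∧
      ‖t‖ ≤ (∑ a ∈ Z, |(n a : ℝ)|) * (2 * (K / r) ^ (m + 1)) := by
  have hbd : ∀ a ∈ Z, ‖z / a‖ ≤ K / r := by
    intro a ha
    rw [norm_div]
    have := hZ a ha
    gcongr
    exact (norm_nonneg z).trans hz
  have hK2 : K / r ≤ 1 / 2 := by rw [div_le_iff₀ hr]; linarith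
  have hex : ∀ a, ∃ t : ℂ, a ∈ Z → primeFactor m (z / a) = Complex.exp t ∧
      ‖t‖ ≤ 2 * (K / r) ^ (m + 1) := by
    intro a
    by_cases ha : a ∈ Z
    · obtain ⟨t, ht1, ht2⟩ := primeFactor_eq_exp m ((hbd a ha).trans hK2)
      refine ⟨t, fun _ => ⟨ht1, ht2.trans ?_⟩⟩
      have := hbd a ha
      gcongr
    · exact ⟨0, fun h => absurd h ha⟩
  choose t ht using hex
  refine ⟨∑ a ∈ Z, (n a : ℂ) * t a, ?_, ?_⟩
  · rw [Complex.exp_sum]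
    refine Finset.prod_congr rfl fun a ha => ?_
    rw [(ht a ha).1, ← Complex.exp_int_mul]
  · rw [Finset.sum_mul]
    refine norm_sum_le_of_le _ fun a ha => ?_
    rw [norm_mul, Complex.norm_intCast]
    exact mul_le_mul_of_nonneg_left (ht a ha).2 (abs_nonneg _)

/-- Approximants which differ from the limit by a factor `exp (-η)` with `η → 0`. -/
lemma tendstoLocallyUniformlyOn_of_exp {ι : Type*} {l : Filter ι} {F : ι → ℂ → ℂ} {f : ℂ → ℂ}
    {U : Set ℂ} (hf : ContinuousOn f U)
    (h : ∀ K > 0, ∀ ε > 0, ∀ᶠ i in l, ∀ z ∈ U, ‖z‖ ≤ K →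
      ∃ t : ℂ, ‖t‖ ≤ ε ∧ f z = F i z * Complex.exp t) :
    TendstoLocallyUniformlyOn F f l U := by
  rw [Metric.tendstoLocallyUniformlyOn_iff]
  intro ε hε x hx
  set M := ‖f x‖ + 1 with hM
  have hM0 : 0 < M := by positivity
  have h1 : ∀ᶠ z in 𝓝[U] x, ‖f z‖ < M := (hf x hx).norm.eventually (gt_mem_nhds (by linarith))
  have h2 : ∀ᶠ z in 𝓝[U] x, ‖z‖ < ‖x‖ + 1 := eventually_nhdsWithin_of_eventually_nhds
    (continuous_norm.continuousAt.eventually (gt_mem_nhds (by linarith)))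
  refine ⟨{z | ‖f z‖ < M ∧ ‖z‖ < ‖x‖ + 1 ∧ z ∈ U},
    h1.and (h2.and self_mem_nhdsWithin), ?_⟩
  -- For `‖t‖ ≤ 1` one has `|exp(-t) - 1| ≤ 2‖t‖`, so the error is at most `M · 2 · ε/(4M) = ε/2`.
  filter_upwards [h (‖x‖ + 1) (by positivity) (min 1 (ε / (4 * M))) (by positivity)] with i hi z hz
  obtain ⟨hz1, hz2, hzU⟩ := hz
  obtain ⟨t, ht, hft⟩ := hi z hzU hz2.le
  have ht1 : ‖-t‖ ≤ 1 := by rw [norm_neg]; exact ht.trans (min_le_left _ _)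
  have ht2 : ‖t‖ ≤ ε / (4 * M) := ht.trans (min_le_right _ _)
  have hF : F i z = f z * Complex.exp (-t) := by
    rw [hft, mul_assoc, ← Complex.exp_add, add_neg_cancel, Complex.exp_zero, mul_one]
  have he := Complex.norm_exp_sub_one_le ht1
  rw [norm_neg] at he
  rw [dist_comm, dist_eq_norm, hF, show f z * Complex.exp (-t) - f z
    = f z * (Complex.exp (-t) - 1) by ring, norm_mul]
  calc ‖f z‖ * ‖Complex.exp (-t) - 1‖ ≤ M * (2 * (ε / (4 * M))) := by
        gcongr
        exact he.trans (by gcongr)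
    _ = ε / 2 := by field_simp; ring
    _ < ε := by linarith

/-- The primitive with constant term `ℓ` of the polynomial with coefficients `c`. -/
noncomputable def primitivePoly (ℓ : ℂ) (c : ℕ → ℂ) (n : ℕ) : Polynomial ℂ :=
  Polynomial.C ℓ + ∑ k ∈ Finset.range n, Polynomial.C (c k / (k + 1)) * Polynomial.X ^ (k + 1)

lemma natDegree_primitivePoly_le (ℓ : ℂ) (c : ℕ → ℂ) (n : ℕ) :
    (primitivePoly ℓ c n).natDegree ≤ n := by
  refine (Polynomial.natDegree_add_le _ _).trans (max_le (by simp) ?_)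
  refine Polynomial.natDegree_sum_le_of_forall_le _ _ fun k hk => ?_
  refine (Polynomial.natDegree_C_mul_X_pow_le _ _).trans ?_
  have := Finset.mem_range.1 hk
  omega

lemma eval_primitivePoly (ℓ : ℂ) (c : ℕ → ℂ) (n : ℕ) (z : ℂ) : (primitivePoly ℓ c n).eval z
    = ℓ + ∑ k ∈ Finset.range n, c k * (z ^ (k + 1) / (k + 1 : ℂ)) := by
  simp only [primitivePoly, Polynomial.eval_add, Polynomial.eval_C, Polynomial.eval_finsetSum,
    Polynomial.eval_mul, Polynomial.eval_pow, Polynomial.eval_X]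
  congr 1
  exact Finset.sum_congr rfl fun k _ => by ring

variable {α β : ℝ} {f : ℂ → ℂ}

lemma exists_leading_coeff (hf : MeromorphicNFOn f Set.univ)
    (hfin : ∀ z, meromorphicOrderAt f z ≠ ⊤) :
    ∃ ℓ : ℂ, Tendsto (fun z => f z * z ^ (-mult f 0)) (𝓝[≠] 0) (𝓝 (Complex.exp ℓ)) := by
  obtain ⟨g, hga, hg0, hg⟩ := (meromorphicOrderAt_eq_int_iff (hf (Set.mem_univ 0)).meromorphicAt).1
    (coe_mult (hfin 0))
  refine ⟨Complex.log (g 0), ?_⟩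
  rw [Complex.exp_log hg0]
  refine (hga.continuousAt.tendsto.mono_left nhdsWithin_le_nhds).congr' ?_
  filter_upwards [hg, self_mem_nhdsWithin] with z hz hz0
  have : z ^ mult f 0 ≠ 0 := zpow_ne_zero _ hz0
  rw [hz, sub_zero, smul_eq_mul, zpow_neg]
  field_simp

lemma exists_punctured_disc (hf : MeromorphicNFOn f Set.univ)
    (hfin : ∀ z, meromorphicOrderAt f z ≠ ⊤) :
    ∃ η > 0, η ≤ 1 / 2 ∧ ∀ a : ℂ, a ≠ 0 → ‖a‖ ≤ η → mult f a = 0 := by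
  have h0 := (hf (Set.mem_univ 0)).meromorphicAt
  have h1 : ∀ᶠ z in 𝓝[≠] (0 : ℂ), mult f z = 0 := by
    filter_upwards [(meromorphicOrderAt_ne_top_iff_eventually_ne_zero h0).1 (hfin 0)] with z hz
    have := (hf (Set.mem_univ z)).meromorphicOrderAt_eq_zero_iff.2 hz
    simp [mult, this]
  rw [eventually_nhdsWithin_iff] at h1
  obtain ⟨η, hη, hball⟩ := Metric.nhds_basis_closedBall.eventually_iff.1 h1
  -- The cap `1 / 2` ensures `η < r`, as all radii used are at least `1`.
  refine ⟨min η (1 / 2), by positivity, min_le_right _ _, fun a ha0 ha => hball ?_ ha0⟩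
  rw [mem_closedBall_zero_iff]
  exact ha.trans (min_le_left _ _)

/-- Representations of a Yosida function in large discs, with control of the error terms and of
the number of zeros and poles near the boundary. -/
theorem IsYosida.exists_representation (hβ : -1 < β) (hf : IsYosida α β f) (m : ℕ) :
    ∃ (ℓ : ℂ) (c : ℕ → ℂ), ∃ C > 0, ∃ R₀ : ℝ, 1 ≤ R₀ ∧ ∀ R, R₀ ≤ R → ∃ r, R ≤ r ∧
      (∀ Z : Finset ℂ, (∀ a ∈ Z, R ≤ ‖a‖ ∧ ‖a‖ ≤ r) →
        ∑ a ∈ Z, |(mult f a : ℝ)| ≤ C * R ^ (1 + β)) ∧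
      ∃ (γ : ℂ) (ε : ℂ → ℂ), ‖γ‖ ≤ C * r ^ (β - m) ∧
        (∀ z, ‖z‖ ≤ r / 2 → ‖ε z‖ ≤ 2 * C * r ^ (β - m - 1) * ‖z‖ ^ (m + 2)) ∧
        ∀ z, ‖z‖ < r → 0 ≤ meromorphicOrderAt f z →
          f z = z ^ mult f 0 * (∏ a ∈ zeroPole f r, primeFactor m (z / a) ^ mult f a) *
            Complex.exp ((primitivePoly ℓ c m).eval z + γ * (z ^ (m + 1) / (m + 1 : ℂ)) + ε z) := by
  obtain ⟨δ, hδ, hδ1, C, hC, R₀, hR₀, H⟩ := hf.exists_annulus_bounds hβ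
  obtain ⟨ℓ, hℓ⟩ := exists_leading_coeff hf.meromorphic hf.order_ne_top
  obtain ⟨η, hη0, hη1, hη⟩ := exists_punctured_disc hf.meromorphic hf.order_ne_top
  refine ⟨ℓ, logCoeff f η, C, hC, R₀, hR₀, fun R hR => ?_⟩
  obtain ⟨hcount, r, hr1, hr2, hr3, hint⟩ := H R hR
  refine ⟨r, hr1, fun Z hZ => hcount Z fun a ha => ⟨(hZ a ha).1, (hZ a ha).2.trans hr2⟩, ?_⟩
  obtain ⟨γ, ε, h1, h2, h3⟩ := exists_exp_representation hf.meromorphic hf.order_ne_top m hη0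
    (by linarith) hη hr3 hint hℓ
  exact ⟨γ, ε, h1, h2, fun z hz hnn => by rw [eval_primitivePoly]; exact h3 z hz hnn⟩

lemma IsYosida.continuousOn (hf : IsYosida α β f) :
    ContinuousOn f {z | 0 ≤ meromorphicOrderAt f z} := fun z hz =>
  ((hf.meromorphicNFAt z).meromorphicOrderAt_nonneg_iff_analyticAt.1
    hz).continuousAt.continuousWithinAt

lemma tendsto_rpow_neg_mul {x : ℝ} (hx : x < 0) (C : ℝ) :
    Tendsto (fun r : ℝ => C * r ^ x) atTop (𝓝 0) := by
  have := (tendsto_rpow_neg_atTop (neg_pos.2 hx)).const_mul C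
  simpa using this

/-- An arbitrary `R` is compared with a good `r ≥ R` in its thin annulus. The additional factors,
the term with `γ` and the remainder are each `O(R^(β-m))` on compact sets. -/
theorem IsYosida.product_of_lt (hβ : -1 < β) (hf : IsYosida α β f) {m : ℕ} (hm : β < m) :
    ∃ (s : ℤ) (S : Polynomial ℂ), S.natDegree ≤ m ∧
      TendstoLocallyUniformlyOn
        (fun (r : ℝ) (z : ℂ) => z ^ s * Complex.exp (S.eval z) *
          (zeroProd (primeFactor m) f r z / poleProd (primeFactor m) f r z))
        f atTop {z | 0 ≤ meromorphicOrderAt f z} := by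
  classical
  obtain ⟨ℓ, c, C, hC, R₀, hR₀, H⟩ := hf.exists_representation hβ m
  refine ⟨mult f 0, primitivePoly ℓ c m, natDegree_primitivePoly_le _ _ _,
    tendstoLocallyUniformlyOn_of_exp hf.continuousOn fun K hK ε hε => ?_⟩
  -- The summands bound, in this order, the annulus factors, the `γ` term and the remainder on `‖z‖
  -- ≤ K`.
  set D := C * 2 * K ^ (m + 1) + C * K ^ (m + 1) + 2 * C * K ^ (m + 2) with hD
  filter_upwards [eventually_ge_atTop R₀, eventually_gt_atTop (2 * K),
    (tendsto_rpow_neg_mul (sub_neg.2 hm) D).eventually (gt_mem_nhds hε)] with R hR hRK hRε z hz hzK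
  obtain ⟨r, hRr, hcount, γ, e, hγ, he, hrep⟩ := H R hR
  have hR1 : 1 ≤ R := hR₀.trans hR
  have hR0 : 0 < R := by linarith
  have hr0 : 0 < r := by linarith
  have hsub : zeroPole f R ⊆ zeroPole f r := by
    intro a ha
    rw [mem_zeroPole hf.meromorphic] at ha ⊢
    exact ⟨ha.1, ha.2.1.trans_le hRr, ha.2.2⟩
  have hZ : ∀ a ∈ zeroPole f r \ zeroPole f R, R ≤ ‖a‖ ∧ ‖a‖ ≤ r := by
    intro a ha
    rw [Finset.mem_sdiff, mem_zeroPole hf.meromorphic, mem_zeroPole hf.meromorphic] at ha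
    obtain ⟨⟨h1, h2, h3⟩, h4⟩ := ha
    refine ⟨?_, h2.le⟩
    by_contra hc
    exact h4 ⟨h1, not_le.1 hc, h3⟩
  obtain ⟨t, ht, htb⟩ := prod_primeFactor_eq_exp m (mult f) (zeroPole f r \ zeroPole f R) hR0
    (fun a ha => (hZ a ha).1) hzK (by linarith)
  have hle : r ^ (β - m) ≤ R ^ (β - m) :=
    Real.rpow_le_rpow_of_nonpos hR0 hRr (by linarith)
  have hle2 : r ^ (β - m - 1) ≤ R ^ (β - m) :=
    (Real.rpow_le_rpow_of_nonpos hR0 hRr (by linarith)).trans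
      (Real.rpow_le_rpow_of_exponent_le hR1 (by linarith))
  refine ⟨t + (γ * (z ^ (m + 1) / (m + 1 : ℂ)) + e z), ?_, ?_⟩
  · have h1 : ‖t‖ ≤ C * 2 * K ^ (m + 1) * R ^ (β - m) := by
      refine htb.trans ?_
      have hp : R ^ (1 + β) * (1 / R) ^ (m + 1) = R ^ (β - m) := by
        rw [one_div, inv_pow, ← Real.rpow_natCast, ← Real.rpow_neg hR0.le, ← Real.rpow_add hR0]
        congr 1
        push_cast
        ring
      calc _ ≤ C * R ^ (1 + β) * (2 * (K / R) ^ (m + 1)) := by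
            gcongr
            exact hcount _ hZ
        _ = C * 2 * K ^ (m + 1) * (R ^ (1 + β) * (1 / R) ^ (m + 1)) := by
            rw [div_eq_mul_one_div K R, mul_pow]; ring
        _ = _ := by rw [hp]
    have h2 : ‖γ * (z ^ (m + 1) / (m + 1 : ℂ))‖ ≤ C * K ^ (m + 1) * R ^ (β - m) := by
      rw [norm_mul, norm_div, norm_pow]
      have hm1 : 1 ≤ ‖(m + 1 : ℂ)‖ := by
        rw [show (m + 1 : ℂ) = ((m + 1 : ℕ) : ℂ) by push_cast; rfl, Complex.norm_natCast]
        exact_mod_cast Nat.le_add_left 1 m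
      calc ‖γ‖ * (‖z‖ ^ (m + 1) / ‖(m + 1 : ℂ)‖) ≤ C * R ^ (β - m) * (K ^ (m + 1) / 1) := by
            gcongr
            exact hγ.trans (by gcongr)
        _ = _ := by ring
    have h3 : ‖e z‖ ≤ 2 * C * K ^ (m + 2) * R ^ (β - m) := by
      calc ‖e z‖ ≤ 2 * C * r ^ (β - m - 1) * ‖z‖ ^ (m + 2) := he z (by linarith)
        _ ≤ 2 * C * R ^ (β - m) * K ^ (m + 2) := by gcongr
        _ = _ := by ring
    calc _ ≤ ‖t‖ + (‖γ * (z ^ (m + 1) / (m + 1 : ℂ))‖ + ‖e z‖) :=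
          (norm_add_le _ _).trans (by gcongr; exact norm_add_le _ _)
      _ ≤ D * R ^ (β - m) := by rw [hD]; linarith
      _ ≤ ε := hRε.le
  · rw [zeroProd_div_poleProd hf.meromorphic, hrep z (by linarith) hz,
      ← Finset.prod_sdiff hsub, ht, add_assoc ((primitivePoly ℓ c m).eval z), Complex.exp_add,
      Complex.exp_add t]
    ring

/-- Here `γ` is merely bounded by `C`. Bolzano–Weierstrass selects good radii along which it
converges, and the limit becomes the additional top coefficient. The annulus factors would only be
`O(1)`, so the radii stay restricted to this sequence. -/
theorem IsYosida.product_of_eq (hβ : -1 < β) (hf : IsYosida α β f) {b : ℕ} (hb : β = b) :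
    ∃ (ρ : ℕ → ℝ) (S : Polynomial ℂ), Tendsto ρ atTop atTop ∧ S.natDegree ≤ b + 1 ∧
      TendstoLocallyUniformlyOn
        (fun (k : ℕ) (z : ℂ) => z ^ mult f 0 * Complex.exp (S.eval z) *
          (zeroProd (primeFactor b) f (ρ k) z / poleProd (primeFactor b) f (ρ k) z))
        f atTop {z | 0 ≤ meromorphicOrderAt f z} := by
  obtain ⟨ℓ, c, C, hC, R₀, hR₀, H⟩ := hf.exists_representation hβ b
  choose r hRr _ γ e hγ he hrep using fun k : ℕ => H (R₀ + k) (by simp)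
  have hγC : ∀ k, γ k ∈ closedBall (0 : ℂ) C := by
    intro k
    rw [mem_closedBall_zero_iff]
    simpa [hb] using hγ k
  obtain ⟨γ', -, φ, hφ, hlim⟩ := tendsto_subseq_of_bounded isBounded_closedBall hγC
  have hrt : Tendsto (fun k => r (φ k)) atTop atTop := by
    refine tendsto_atTop_mono (fun k => ?_) tendsto_natCast_atTop_atTop
    have h1 : (k : ℝ) ≤ φ k := by exact_mod_cast hφ.id_le k
    have := hRr (φ k)
    linarith
  set c' : ℕ → ℂ := fun k => if k < b then c k else γ' with hc'
  have heval : ∀ z, (primitivePoly ℓ c' (b + 1)).eval z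
      = (primitivePoly ℓ c b).eval z + γ' * (z ^ (b + 1) / (b + 1 : ℂ)) := by
    intro z
    rw [eval_primitivePoly, eval_primitivePoly, Finset.sum_range_succ, add_assoc]
    congr 2
    · refine Finset.sum_congr rfl fun k hk => ?_
      simp [hc', Finset.mem_range.1 hk]
    · simp [hc']
  refine ⟨fun k => r (φ k), primitivePoly ℓ c' (b + 1), hrt,
    natDegree_primitivePoly_le _ _ _,
    tendstoLocallyUniformlyOn_of_exp hf.continuousOn fun K hK ε hε => ?_⟩
  have hγ0 : Tendsto (fun k => ‖γ (φ k) - γ'‖ * K ^ (b + 1)) atTop (𝓝 0) := by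
    have h1 := ((tendsto_iff_norm_sub_tendsto_zero.1 hlim).mul_const (K ^ (b + 1)))
    simpa using h1
  have he0 := (tendsto_rpow_neg_mul (x := -1) (by norm_num) (2 * C * K ^ (b + 2))).comp hrt
  filter_upwards [hrt.eventually_gt_atTop (2 * K), hγ0.eventually (gt_mem_nhds (half_pos hε)),
    he0.eventually (gt_mem_nhds (half_pos hε))] with k hk h1 h2 z hz hzK
  refine ⟨(γ (φ k) - γ') * (z ^ (b + 1) / (b + 1 : ℂ)) + e (φ k) z, ?_, ?_⟩
  · have hm1 : 1 ≤ ‖(b + 1 : ℂ)‖ := by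
      rw [show (b + 1 : ℂ) = ((b + 1 : ℕ) : ℂ) by push_cast; rfl, Complex.norm_natCast]
      exact_mod_cast Nat.le_add_left 1 b
    have h3 : ‖(γ (φ k) - γ') * (z ^ (b + 1) / (b + 1 : ℂ))‖ ≤ ‖γ (φ k) - γ'‖ * K ^ (b + 1) := by
      rw [norm_mul, norm_div, norm_pow]
      calc _ ≤ ‖γ (φ k) - γ'‖ * (K ^ (b + 1) / 1) := by gcongr
        _ = _ := by ring
    have h4 : ‖e (φ k) z‖ ≤ 2 * C * K ^ (b + 2) * r (φ k) ^ (-1 : ℝ) := by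
      have h5 := he (φ k) z (by linarith)
      rw [hb, sub_self, zero_sub] at h5
      have hr0 : 0 < r (φ k) := by linarith
      calc _ ≤ 2 * C * r (φ k) ^ (-1 : ℝ) * ‖z‖ ^ (b + 2) := h5
        _ ≤ 2 * C * r (φ k) ^ (-1 : ℝ) * K ^ (b + 2) := by gcongr
        _ = _ := by ring
    simp only [Function.comp] at h2
    refine (norm_add_le _ _).trans ?_
    linarith
  · have h6 : (primitivePoly ℓ c b).eval z + γ (φ k) * (z ^ (b + 1) / (b + 1 : ℂ)) + e (φ k) z
        = (primitivePoly ℓ c' (b + 1)).eval z +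
          ((γ (φ k) - γ') * (z ^ (b + 1) / (b + 1 : ℂ)) + e (φ k) z) := by
      rw [heval]; ring
    rw [zeroProd_div_poleProd hf.meromorphic, hrep (φ k) z (by linarith) hz, h6, Complex.exp_add]
    ring

lemma isOpen_order_eq_zero (hf : MeromorphicNFOn f Set.univ) :
    IsOpen {z | meromorphicOrderAt f z = 0} := by
  rw [isOpen_iff_mem_nhds]
  intro z hz
  have hzN := hf (Set.mem_univ z)
  have h1 := hzN.meromorphicOrderAt_nonneg_iff_analyticAt.1 (le_of_eq hz.symm)
  filter_upwards [h1.continuousAt.eventually_ne (hzN.meromorphicOrderAt_eq_zero_iff.1 hz)] with w hw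
  exact (hf (Set.mem_univ w)).meromorphicOrderAt_eq_zero_iff.2 hw

lemma logDeriv_linear_product (hf : MeromorphicNFOn f Set.univ) (a c : ℂ) (r : ℝ) {z : ℂ}
    (hz : meromorphicOrderAt f z = 0) :
    DifferentiableAt ℂ (fun z => z ^ mult f 0 * Complex.exp (a * z + c) *
        ∏ q ∈ zeroPole f r, (1 - z / q) ^ mult f q) z ∧
      logDeriv (fun z => z ^ mult f 0 * Complex.exp (a * z + c) *
        ∏ q ∈ zeroPole f r, (1 - z / q) ^ mult f q) z
        = a + (mult f 0 : ℂ) / z + ∑ q ∈ zeroPole f r, (mult f q : ℂ) * (z - q)⁻¹ := by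
  have hm : mult f z = 0 := by simp [mult, hz]
  -- The origin is admitted only when it is neither a zero nor a pole; then `z ^ 0 = 1`, and the
  -- term `0 / 0` has value `0`, as it should.
  have h0 : z ≠ 0 ∨ mult f 0 = 0 := by
    by_cases h : z = 0
    · right; rwa [h] at hm
    · left; exact h
  have hq : ∀ q ∈ zeroPole f r, q ≠ 0 ∧ z - q ≠ 0 ∧ 1 - z / q ≠ 0 := by
    intro q hq
    obtain ⟨h1, -, h2⟩ := (mem_zeroPole hf).1 hq
    have h3 : z ≠ q := by rintro rfl; exact h2 hm
    refine ⟨h1, sub_ne_zero.2 h3, sub_ne_zero.2 fun h => h3 ?_⟩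
    field_simp at h
    exact h.symm
  have hd1 : DifferentiableAt ℂ (fun z : ℂ => z ^ mult f 0) z :=
    differentiableAt_zpow.2 (h0.imp id fun h => h.ge)
  have hn1 : z ^ mult f 0 ≠ 0 := by
    rcases h0 with h | h
    · exact zpow_ne_zero _ h
    · simp [h]
  have hd2 : DifferentiableAt ℂ (fun z => Complex.exp (a * z + c)) z := by fun_prop
  have hn2 := Complex.exp_ne_zero (a * z + c)
  have hdl : ∀ q, DifferentiableAt ℂ (fun z => 1 - z / q) z := fun q => by fun_prop
  have hd3 : ∀ q ∈ zeroPole f r, DifferentiableAt ℂ (fun z => (1 - z / q) ^ mult f q) z :=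
    fun q hq' => (hdl q).zpow (Or.inl (hq q hq').2.2)
  have hn3 : ∀ q ∈ zeroPole f r, (1 - z / q) ^ mult f q ≠ 0 := fun q hq' =>
    zpow_ne_zero _ (hq q hq').2.2
  have hP : DifferentiableAt ℂ (fun z => ∏ q ∈ zeroPole f r, (1 - z / q) ^ mult f q) z :=
    .fun_finsetProd hd3
  have hPn := Finset.prod_ne_zero_iff.2 hn3
  refine ⟨(hd1.fun_mul hd2).fun_mul hP, ?_⟩
  rw [logDeriv_mul (f := fun z => z ^ mult f 0 * Complex.exp (a * z + c)) z (mul_ne_zero hn1 hn2) hPn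
    (hd1.fun_mul hd2) hP, logDeriv_mul (f := fun z => z ^ mult f 0) z hn1 hn2 hd1 hd2, logDeriv_zpow,
    logDeriv_prod (f := fun q z => (1 - z / q) ^ mult f q) hn3 hd3]
  have he : logDeriv (fun z => Complex.exp (a * z + c)) z = a := by
    have h1 : HasDerivAt (fun z => Complex.exp (a * z + c)) (Complex.exp (a * z + c) * (a * 1)) z :=
      (((hasDerivAt_id' z).const_mul a).add_const c).cexp
    rw [logDeriv_apply, h1.deriv]
    field_simp
  rw [he, add_comm _ a]
  congr 1
  refine Finset.sum_congr rfl fun q hq' => ?_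
  obtain ⟨h1, h2, h3⟩ := hq q hq'
  have h4 : HasDerivAt (fun z : ℂ => 1 - z / q) (-(1 / q)) z :=
    ((hasDerivAt_id' z).div_const q).const_sub 1
  rw [logDeriv_fun_zpow (f := fun z => 1 - z / q) (hdl q), logDeriv_apply, h4.deriv]
  have h5 : q - z ≠ 0 := by rw [← neg_sub]; exact neg_ne_zero.2 h2
  congr 1
  rw [← neg_sub q z]
  field_simp

/-- Locally uniform convergence of holomorphic functions passes to derivatives, and to quotients
where the limit has no zeros. So the second limit holds along the same radii and with the same `a`
as the first. -/
theorem IsYosida.product_of_eq_zero (hf : IsYosida α β f) (hβ0 : β = 0) :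
    ∃ (ρ : ℕ → ℝ) (a c : ℂ), Tendsto ρ atTop atTop ∧
      TendstoLocallyUniformlyOn
        (fun (k : ℕ) (z : ℂ) => z ^ mult f 0 * Complex.exp (a * z + c) *
          (zeroProd (fun u => 1 - u) f (ρ k) z / poleProd (fun u => 1 - u) f (ρ k) z))
        f atTop {z | 0 ≤ meromorphicOrderAt f z} ∧
      TendstoLocallyUniformlyOn
        (fun (k : ℕ) (z : ℂ) => a + (mult f 0 : ℂ) / z + (zeroSum f (ρ k) z - poleSum f (ρ k) z))
        (fun z => deriv f z / f z) atTop {z | meromorphicOrderAt f z = 0} := by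
  obtain ⟨ρ, S, hρ, hS, hlim⟩ := hf.product_of_eq (by linarith) (b := 0) (by simpa using hβ0)
  obtain ⟨a, c, rfl⟩ := Polynomial.exists_eq_X_add_C_of_natDegree_le_one (by simpa using hS)
  simp only [primeFactor_genus_zero, Polynomial.eval_add, Polynomial.eval_mul, Polynomial.eval_C,
    Polynomial.eval_X] at hlim
  refine ⟨ρ, a, c, hρ, hlim, ?_⟩
  have hopen := isOpen_order_eq_zero hf.meromorphic
  have hlim' := hlim.mono
    (show {z | meromorphicOrderAt f z = 0} ⊆ {z | 0 ≤ meromorphicOrderAt f z} from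
      fun z hz => le_of_eq (Eq.symm hz))
  simp only [zeroProd_div_poleProd hf.meromorphic] at hlim'
  have han : AnalyticOnNhd ℂ f {z | meromorphicOrderAt f z = 0} := fun z hz =>
    (hf.meromorphicNFAt z).meromorphicOrderAt_nonneg_iff_analyticAt.1 (le_of_eq (Eq.symm hz))
  have hd := hlim'.deriv (.of_forall fun k z hz =>
    (logDeriv_linear_product hf.meromorphic a c (ρ k) hz).1.differentiableWithinAt) hopen
  refine (hd.div₀ hlim' han.deriv.continuousOn han.continuousOn fun z hz =>
    (hf.meromorphicNFAt z).meromorphicOrderAt_eq_zero_iff.1 hz).congr fun k z hz => ?_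
  rw [zeroSum_sub_poleSum hf.meromorphic,
    ← (logDeriv_linear_product hf.meromorphic a c (ρ k) hz).2]
  rfl

end Yosida

/-- Since `β > -1`, every integer `m > β`, and `β` itself if integral, is a natural number. The set
of points of order `≥ 0` is the complement of the poles, where no factor of `poleProd` vanishes; the
exponent supplied is `mult f 0`, non-negative if the origin belongs to that set. -/
theorem theorem17 (α β : ℝ) (hβ : -1 < β) (f : ℂ → ℂ) (hf : Yosida.IsYosida α β f) :
    -- every integer `m > β`
    (∀ m : ℕ, β < (m : ℝ) →
      ∃ (s : ℤ) (S : Polynomial ℂ), S.natDegree ≤ m ∧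
        TendstoLocallyUniformlyOn
          (fun (r : ℝ) (z : ℂ) => z ^ s * Complex.exp (S.eval z) *
            (Yosida.zeroProd (Yosida.primeFactor m) f r z /
              Yosida.poleProd (Yosida.primeFactor m) f r z))
          f atTop {z | 0 ≤ meromorphicOrderAt f z}) ∧
    -- integral `β`
    (∀ b : ℕ, β = (b : ℝ) →
      ∃ (ρ : ℕ → ℝ) (s : ℤ) (S : Polynomial ℂ), Tendsto ρ atTop atTop ∧ S.natDegree ≤ b + 1 ∧
        TendstoLocallyUniformlyOn
          (fun (k : ℕ) (z : ℂ) => z ^ s * Complex.exp (S.eval z) *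
            (Yosida.zeroProd (Yosida.primeFactor b) f (ρ k) z /
              Yosida.poleProd (Yosida.primeFactor b) f (ρ k) z))
          f atTop {z | 0 ≤ meromorphicOrderAt f z}) ∧
    -- the particular case `β = 0`
    (β = 0 →
      ∃ (ρ : ℕ → ℝ) (s : ℤ) (a c : ℂ), Tendsto ρ atTop atTop ∧
        TendstoLocallyUniformlyOn
          (fun (k : ℕ) (z : ℂ) => z ^ s * Complex.exp (a * z + c) *
            (Yosida.zeroProd (fun u => 1 - u) f (ρ k) z /
              Yosida.poleProd (fun u => 1 - u) f (ρ k) z))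
          f atTop {z | 0 ≤ meromorphicOrderAt f z} ∧
        TendstoLocallyUniformlyOn
          (fun (k : ℕ) (z : ℂ) => a + (s : ℂ) / z +
            (Yosida.zeroSum f (ρ k) z - Yosida.poleSum f (ρ k) z))
          (fun z => deriv f z / f z) atTop {z | meromorphicOrderAt f z = 0}) := by
  refine ⟨fun m hm => hf.product_of_lt hβ hm, fun b hb => ?_, fun hβ0 => ?_⟩
  · obtain ⟨ρ, S, h⟩ := hf.product_of_eq hβ hb
    exact ⟨ρ, _, S, h⟩
  · obtain ⟨ρ, a, c, h⟩ := hf.product_of_eq_zero hβ0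
    exact ⟨ρ, _, a, c, h⟩
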